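/- Let $N\ge 1$, $0<R_0<R_1$, and let $\Omega:=B_{R_1}(0)\setminus\overline{B}_{R_0}(0)\subset\mathbb R^N$ be the open ring with inner boundary $\Gamma_0:=\partial B_{R_0}(0)$ and outer boundary $\Gamma_1:=\partial B_{R_1}(0)$. Let $f\in L^2(\Omega)\cap L^\infty(\Omega)$, and let $u\in H^1(\Omega)$ be a weak solution of the Signorini problem $$-\Delta u=f\ \text{ in }\Omega,\qquad u=0\ \text{ on }\Gamma_1,\qquad u\ge 0,\quad \partial_\nu u\ge 0,\quad u\,\partial_\nu u=0\ \text{ on }\Gamma_0,$$ that is, $u\in K:=\{v\in H^1(\Omega): v=0\text{ on }\Gamma_1,\ v\ge 0\text{ on }\Gamma_0\text{ in the sense of traces}\}$ and $$\int_\Omega \nabla u\cdot\nabla(v-u)\,dx\ \ge\ \int_\Omega f\,(v-u)\,dx\qquad\text{for all }v\in K.$$ Then $u\in L^\infty(\Omega)$; put $M:=\|u\|_{L^\infty(\Omega)}$. Let moreover $\varepsilon>0$, $R_\varepsilon\in(R_0,R_1]$ and $c>0$ be such that $$f\le-\varepsilon\ \text{ a.e. in }\Omega_\varepsilon:=B_{R_\varepsilon}(0)\setminus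 B_{R_0}(0),\qquad c\le\frac{\varepsilon}{2}\Bigl(1+\frac{N-1}{R_0}(R_\varepsilon-R_0)\Bigr)^{-1},\qquad R_\varepsilon\ge R_0+\sqrt{M/c}.$$ Then $u(x)\le c\,(|x|-R_0)^2$ for a.e. $x\in\Omega_\varepsilon$, the trace of $u$ on $\Gamma_0$ vanishes, and the coincidence set of $u$ on $\Gamma_0$ (the complement in $\Gamma_0$ of the relatively open set of those points that have a neighbourhood in $\Gamma_0$ on which the trace of $u$ is a.e. bounded below by a positive constant) is all of $\Gamma_0$. The value $c=\varepsilon R_0/(4NR_1)$ is always an allowed choice, i.e. it satisfies $0<c\le\frac{\varepsilon}{2}\bigl(1+\frac{N-1}{R_0}(R_\varepsilon-R_0)\bigr)^{-1}$ whenever $R_0<R_\varepsilon\le R_1$. With this choice the size condition is achievable for large $R_1$ in the following sense: for given $N$, $R_0$, $\varepsilon$ and each fixed number $M\ge0$, for all sufficiently large $R_1$ there is $R_\varepsilon\in(R_0,R_1]$ with $R_\varepsilon\ge R_0+\sqrt{M/c}$, where $c=\varepsilon R_0/(4NR_1)$. -/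

import Mathlib

open MeasureTheory Filter Metric Set
open scoped Topology ENNReal

/-- The open ring `B_{R₁}(0) \ closure B_{R₀}(0)` in `ℝ^N`. -/
def openRing (N : ℕ) (R₀ R₁ : ℝ) : Set (EuclideanSpace ℝ (Fin N)) :=
  ball 0 R₁ \ closedBall 0 R₀

/-- `G` is the weak gradient of `u` on the open set `Ω`: for all `φ ∈ C_c^∞(Ω)` and all
directions `e`, `∫_Ω u ∂_e φ = - ∫_Ω φ (G · e)`. -/
def IsWeakGradient {N : ℕ} (Ω : Set (EuclideanSpace ℝ (Fin N)))
    (u : EuclideanSpace ℝ (Fin N) → ℝ)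
    (G : EuclideanSpace ℝ (Fin N) → EuclideanSpace ℝ (Fin N)) : Prop :=
  ∀ φ : EuclideanSpace ℝ (Fin N) → ℝ, ContDiff ℝ (⊤ : ℕ∞) φ → HasCompactSupport φ →
    tsupport φ ⊆ Ω → ∀ e : EuclideanSpace ℝ (Fin N),
      ∫ x in Ω, u x * fderiv ℝ φ x e = - ∫ x in Ω, φ x * inner ℝ (G x) e

/-- The Sobolev space `H¹(Ω)`: a function in `L²(Ω)` together with its weak gradient in `L²(Ω)`.
(Both are representatives defined on `ℝ^N`; only their values a.e. in `Ω` matter.) -/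
structure SobolevH1 {N : ℕ} (Ω : Set (EuclideanSpace ℝ (Fin N))) where
  toFun : EuclideanSpace ℝ (Fin N) → ℝ
  grad : EuclideanSpace ℝ (Fin N) → EuclideanSpace ℝ (Fin N)
  memLp : MemLp toFun 2 (volume.restrict Ω)
  memLp_grad : MemLp grad 2 (volume.restrict Ω)
  isWeakGradient : IsWeakGradient Ω toFun grad

/-- The surface measure on the sphere `∂B_R(0) ⊆ ℝ^N`, as a measure on `ℝ^N`: the image of the
surface measure of the unit sphere under `ω ↦ R ω`, times `R^(N-1)`. -/
noncomputable def sphereMeasure (N : ℕ) (R : ℝ) : Measure (EuclideanSpace ℝ (Fin N)) :=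
  ENNReal.ofReal (R ^ (N - 1)) •
    Measure.map (fun ω : sphere (0 : EuclideanSpace ℝ (Fin N)) 1 =>
        R • (ω : EuclideanSpace ℝ (Fin N)))
      (volume : Measure (EuclideanSpace ℝ (Fin N))).toSphere

/-- `τ ∈ L²(∂B_R(0))` is the trace of `u ∈ H¹(Ω)` on the sphere `∂B_R(0) ⊆ ∂Ω`: the trace
operator is the continuous extension to `H¹(Ω)` of the restriction of `C¹` functions, that is,
some `C¹` functions converge to `u` in `H¹(Ω)` and to `τ` in `L²(∂B_R(0))`. -/
def SobolevH1.HasTraceOnSphere {N : ℕ} {Ω : Set (EuclideanSpace ℝ (Fin N))} (u : SobolevH1 Ω)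
    (R : ℝ) (τ : EuclideanSpace ℝ (Fin N) → ℝ) : Prop :=
  MemLp τ 2 (sphereMeasure N R) ∧
  ∃ φ : ℕ → EuclideanSpace ℝ (Fin N) → ℝ,
    (∀ n, ContDiff ℝ 1 (φ n)) ∧
    Tendsto (fun n => eLpNorm (fun x => φ n x - u.toFun x) 2 (volume.restrict Ω)) atTop (𝓝 0) ∧
    Tendsto (fun n => eLpNorm (fun x => gradient (φ n) x - u.grad x) 2 (volume.restrict Ω))
      atTop (𝓝 0) ∧
    Tendsto (fun n => eLpNorm (fun x => φ n x - τ x) 2 (sphereMeasure N R)) atTop (𝓝 0)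

/-- The convex set `K` of all `v ∈ H¹(Ω)`, `Ω` the ring, with `v = 0` on the outer sphere
`Γ₁ = ∂B_{R₁}(0)` and `v ≥ 0` on the inner sphere `Γ₀ = ∂B_{R₀}(0)`, in the sense of traces. -/
def admissibleSet (N : ℕ) (R₀ R₁ : ℝ) : Set (SobolevH1 (openRing N R₀ R₁)) :=
  {v | (∃ τ, v.HasTraceOnSphere R₁ τ ∧ ∀ᵐ x ∂(sphereMeasure N R₁), τ x = 0) ∧
       (∃ τ, v.HasTraceOnSphere R₀ τ ∧ ∀ᵐ x ∂(sphereMeasure N R₀), 0 ≤ τ x)}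

/-- `u` is a weak solution of the Signorini problem on the ring,
`-Δu = f` in `Ω`, `u = 0` on `Γ₁`, and `u ≥ 0`, `∂_ν u ≥ 0`, `u ∂_ν u = 0` on `Γ₀`:
`u ∈ K` and `∫_Ω ∇u · ∇(v - u) ≥ ∫_Ω f (v - u)` for all `v ∈ K`. -/
def IsSignoriniSolution {N : ℕ} {R₀ R₁ : ℝ} (f : EuclideanSpace ℝ (Fin N) → ℝ)
    (u : SobolevH1 (openRing N R₀ R₁)) : Prop :=
  u ∈ admissibleSet N R₀ R₁ ∧
  ∀ v ∈ admissibleSet N R₀ R₁,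
    ∫ x in openRing N R₀ R₁, f x * (v.toFun x - u.toFun x) ≤
      ∫ x in openRing N R₀ R₁, inner ℝ (u.grad x) (v.grad x - u.grad x)

/-- The coincidence set on the sphere `∂B_R(0)` of a function with trace `τ` (for the zero
obstacle): the complement in the sphere of the relatively open set of the points near which the
trace is positive, i.e. bounded below a.e. by a positive constant. -/
def coincidenceSet {N : ℕ} (R : ℝ) (τ : EuclideanSpace ℝ (Fin N) → ℝ) :
    Set (EuclideanSpace ℝ (Fin N)) :=
  {x ∈ sphere 0 R | ¬ ∃ ρ > 0, ∃ δ > 0, ∀ᵐ y ∂(sphereMeasure N R), y ∈ ball x ρ → δ ≤ τ y}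

/-! The bounds on `u` are comparisons with a radial barrier `w` that is nonnegative on both spheres.
Let `ρ` be `ramp`, a `C¹` function with `0 ≤ ρ(s) ≤ s⁺` and `0 ≤ ρ' ≤ 1`, and put `ψ = ρ(u - w)`.
Then `u - ψ` still lies in `K`, so the variational inequality gives `∫ ∇u · ∇ψ ≤ ∫ f ψ`. The field
`∇w = a(|x|) x/|x|` is radial, `ψ` vanishes on the outer sphere and `a(R₀) ≤ 0`, so the divergence
theorem gives `∫ ∇w · ∇ψ + ∫ Δw ψ ≥ 0`. Subtracting, `∫ ρ'(u - w) |∇(u - w)|² ≤ ∫ (f + Δw) ψ`. If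
the right side is at most `0`, then `∇ψ = 0`, hence `ψ = 0` and `u ≤ w`. This is
`IsSignoriniSolution.ae_mul_le`, stated for `s u` with `s = ±1` so that it also yields lower bounds.

With `w = F (R₁² - |x|²) / (2N)`, where `|f| ≤ F` and `-Δw = F`, both signs give `u ∈ L^∞`. With `w
= c ((|x| - R₀)⁺)²`, the bound on `c` says that `Δw ≤ ε ≤ -f` for `|x| < Rε`, while for `|x| ≥ Rε`
the size condition gives `w ≥ M ≥ u`, so that `ψ = 0` there. Thus `u ≤ w`. As `w = 0` on the inner
sphere, the trace of `u` there is at most `0`, and membership in `K` makes it at least `0`.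

All identities are proved for `C¹` functions and passed to `L²` limits along the approximating
sequences contained in the definition of the trace. This is why the truncation is `C¹` rather than
the positive part. The divergence theorem for radial fields
(`integral_radialField_inner_gradient_add`) serves three times: for the barrier, in place of a
Poincaré inequality, and for the uniqueness of traces (`ApproxByC1.ae_sphereMeasure_eq_zero`). -/

/-! ### A `C¹` ramp function -/

/-- A `C¹` substitute of the positive part: `s ↦ (s⁺)² / (1 + s⁺)`. -/
noncomputable def ramp (s : ℝ) : ℝ := (max s 0) ^ 2 / (1 + max s 0)

/-- The derivative of `ramp`. -/
noncomputable def rampDeriv (s : ℝ) : ℝ := 1 - 1 / (1 + max s 0) ^ 2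

theorem one_add_posPart_pos (s : ℝ) : 0 < 1 + max s 0 := by positivity

theorem continuous_ramp : Continuous ramp := by
  unfold ramp
  exact Continuous.div (by fun_prop) (by fun_prop) fun s => (one_add_posPart_pos s).ne'

theorem continuous_rampDeriv : Continuous rampDeriv := by
  unfold rampDeriv
  exact continuous_const.sub (Continuous.div (by fun_prop) (by fun_prop)
    fun s => (pow_pos (one_add_posPart_pos s) 2).ne')

theorem ramp_of_nonpos {s : ℝ} (hs : s ≤ 0) : ramp s = 0 := by simp [ramp, hs]

theorem rampDeriv_of_nonpos {s : ℝ} (hs : s ≤ 0) : rampDeriv s = 0 := by simp [rampDeriv, hs]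

theorem ramp_nonneg (s : ℝ) : 0 ≤ ramp s := by
  have := one_add_posPart_pos s
  unfold ramp; positivity

theorem ramp_pos {s : ℝ} (hs : 0 < s) : 0 < ramp s := by
  simp only [ramp, max_eq_left hs.le]; positivity

theorem ramp_le_max (s : ℝ) : ramp s ≤ max s 0 := by
  have h := one_add_posPart_pos s
  have h0 : 0 ≤ max s 0 := le_max_right _ _
  rw [ramp, div_le_iff₀ h]; nlinarith

theorem nonpos_of_ramp_eq_zero {s : ℝ} (h : ramp s = 0) : s ≤ 0 := by
  by_contra! hs
  exact (ramp_pos hs).ne' h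

theorem rampDeriv_nonneg (s : ℝ) : 0 ≤ rampDeriv s := by
  have h0 : 0 ≤ max s 0 := le_max_right _ _
  rw [rampDeriv, sub_nonneg]
  exact div_le_one_of_le₀ (by nlinarith) (by positivity)

theorem rampDeriv_le_one (s : ℝ) : rampDeriv s ≤ 1 := by
  have := one_add_posPart_pos s
  rw [rampDeriv, sub_le_self_iff]; positivity

theorem hasDerivAt_ramp (s : ℝ) : HasDerivAt ramp (rampDeriv s) s := by
  have hne : ∀ y, y ≠ 0 → HasDerivAt ramp (rampDeriv y) y := by
    intro y hy
    rcases lt_or_gt_of_ne hy with hy | hy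
    · rw [rampDeriv_of_nonpos hy.le]
      refine (hasDerivAt_const y (0 : ℝ)).congr_of_eventuallyEq ?_
      filter_upwards [Iio_mem_nhds hy] with z hz using ramp_of_nonpos (le_of_lt hz)
    · have h1 : (1 + y) ≠ 0 := by positivity
      have h2 : HasDerivAt (fun z : ℝ => z ^ 2 / (1 + z)) (rampDeriv y) y := by
        have := ((hasDerivAt_id y).pow 2).div ((hasDerivAt_id y).const_add 1) h1
        refine this.congr_deriv ?_
        simp only [rampDeriv, max_eq_left hy.le, id]
        field_simp
        simp
        ring
      refine h2.congr_of_eventuallyEq ?_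
      filter_upwards [Ioi_mem_nhds hy] with z hz
      simp [ramp, max_eq_left (le_of_lt (mem_Ioi.1 hz))]
  -- At `0` the derivative exists because the derivatives at nearby points extend continuously.
  rcases eq_or_ne s 0 with rfl | hs
  · exact hasDerivAt_of_hasDerivAt_of_ne (fun y hy => hne y hy)
      continuous_ramp.continuousAt continuous_rampDeriv.continuousAt
  · exact hne s hs

theorem contDiff_ramp : ContDiff ℝ 1 ramp := by
  rw [contDiff_one_iff_deriv]
  refine ⟨fun s => (hasDerivAt_ramp s).differentiableAt, ?_⟩
  have : deriv ramp = rampDeriv := funext fun s => (hasDerivAt_ramp s).deriv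
  rw [this]; exact continuous_rampDeriv

theorem abs_ramp_sub_le (s t : ℝ) : |ramp s - ramp t| ≤ |s - t| := by
  have h : LipschitzWith 1 ramp := by
    refine lipschitzWith_of_nnnorm_deriv_le (fun s => (hasDerivAt_ramp s).differentiableAt) ?_
    intro x
    rw [(hasDerivAt_ramp x).deriv, ← NNReal.coe_le_coe, coe_nnnorm, Real.norm_eq_abs,
      abs_of_nonneg (rampDeriv_nonneg x)]
    simpa using rampDeriv_le_one x
  simpa [Real.dist_eq] using h.dist_le_mul s t

/-! ### Limits in `L²` -/

/-- The integral is the inner product of `L²`, which is jointly continuous. -/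
theorem tendsto_integral_inner_of_tendsto_eLpNorm {α F : Type*} [MeasurableSpace α]
    {μ : Measure α} [NormedAddCommGroup F] [InnerProductSpace ℝ F] {X G : α → F}
    {Xn Gn : ℕ → α → F} (hX : MemLp X 2 μ) (hXn : ∀ n, MemLp (Xn n) 2 μ) (hG : MemLp G 2 μ)
    (hGn : ∀ n, MemLp (Gn n) 2 μ)
    (hXlim : Tendsto (fun n => eLpNorm (fun x => Xn n x - X x) 2 μ) atTop (𝓝 0))
    (hGlim : Tendsto (fun n => eLpNorm (fun x => Gn n x - G x) 2 μ) atTop (𝓝 0)) :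
    Tendsto (fun n => ∫ x, inner ℝ (Xn n x) (Gn n x) ∂μ) atTop
      (𝓝 (∫ x, inner ℝ (X x) (G x) ∂μ)) := by
  have key : ∀ {A B : α → F} (hA : MemLp A 2 μ) (hB : MemLp B 2 μ),
      ∫ x, inner ℝ (A x) (B x) ∂μ = inner ℝ (hA.toLp A) (hB.toLp B) := by
    intro A B hA hB
    rw [L2.inner_def]
    refine integral_congr_ae ?_
    filter_upwards [hA.coeFn_toLp, hB.coeFn_toLp] with x h1 h2
    rw [h1, h2]
  have e : ∀ n, ∫ x, inner ℝ (Xn n x) (Gn n x) ∂μ =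
      inner ℝ ((hXn n).toLp (Xn n)) ((hGn n).toLp (Gn n)) := fun n => key _ _
  simp only [e, key hX hG]
  have h1 := (Lp.tendsto_Lp_iff_tendsto_eLpNorm'' Xn hXn X hX).2 hXlim
  have h2 := (Lp.tendsto_Lp_iff_tendsto_eLpNorm'' Gn hGn G hG).2 hGlim
  exact h1.inner h2

theorem tendsto_integral_mul_of_tendsto_eLpNorm {α : Type*} [MeasurableSpace α]
    {μ : Measure α} {X G : α → ℝ}
    {Xn Gn : ℕ → α → ℝ} (hX : MemLp X 2 μ) (hXn : ∀ n, MemLp (Xn n) 2 μ) (hG : MemLp G 2 μ)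
    (hGn : ∀ n, MemLp (Gn n) 2 μ)
    (hXlim : Tendsto (fun n => eLpNorm (fun x => Xn n x - X x) 2 μ) atTop (𝓝 0))
    (hGlim : Tendsto (fun n => eLpNorm (fun x => Gn n x - G x) 2 μ) atTop (𝓝 0)) :
    Tendsto (fun n => ∫ x, Xn n x * Gn n x ∂μ) atTop (𝓝 (∫ x, X x * G x ∂μ)) := by
  have := tendsto_integral_inner_of_tendsto_eLpNorm hG hGn hX hXn hGlim hXlim
  simpa using this

theorem tendsto_integral_const_mul_of_tendsto_eLpNorm {α : Type*} [MeasurableSpace α]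
    {μ : Measure α} {X G : α → ℝ}
    {Gn : ℕ → α → ℝ} (hX : MemLp X 2 μ) (hG : MemLp G 2 μ)
    (hGn : ∀ n, MemLp (Gn n) 2 μ)
    (hGlim : Tendsto (fun n => eLpNorm (fun x => Gn n x - G x) 2 μ) atTop (𝓝 0)) :
    Tendsto (fun n => ∫ x, X x * Gn n x ∂μ) atTop (𝓝 (∫ x, X x * G x ∂μ)) :=
  tendsto_integral_mul_of_tendsto_eLpNorm hX (fun _ => hX) hG hGn (by simp) hGlim

theorem tendsto_eLpNorm_zero_of_le {α F F' : Type*} [MeasurableSpace α] {μ : Measure α}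
    [NormedAddCommGroup F] [NormedAddCommGroup F'] {p : ℝ≥0∞} {A : ℕ → α → F} {B : ℕ → α → F'}
    (C : ℝ) (hB : Tendsto (fun n => eLpNorm (B n) p μ) atTop (𝓝 0))
    (h : ∀ n, ∀ᵐ x ∂μ, ‖A n x‖ ≤ C * ‖B n x‖) :
    Tendsto (fun n => eLpNorm (A n) p μ) atTop (𝓝 0) := by
  have h2 : Tendsto (fun n => ENNReal.ofReal C * eLpNorm (B n) p μ) atTop (𝓝 0) := by
    simpa using ENNReal.Tendsto.const_mul hB (Or.inr ENNReal.ofReal_ne_top)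
  exact tendsto_of_tendsto_of_tendsto_of_le_of_le tendsto_const_nhds h2 (fun _ => zero_le)
    fun n => eLpNorm_le_mul_eLpNorm_of_ae_le_mul (h n) p

theorem tendsto_eLpNorm_zero_of_add {α F : Type*} [MeasurableSpace α] {μ : Measure α}
    [NormedAddCommGroup F] {A B : ℕ → α → F}
    (hAm : ∀ n, AEStronglyMeasurable (A n) μ) (hBm : ∀ n, AEStronglyMeasurable (B n) μ)
    (hA : Tendsto (fun n => eLpNorm (A n) 2 μ) atTop (𝓝 0))
    (hB : Tendsto (fun n => eLpNorm (B n) 2 μ) atTop (𝓝 0)) :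
    Tendsto (fun n => eLpNorm (fun x => A n x + B n x) 2 μ) atTop (𝓝 0) := by
  have h2 := hA.add hB
  rw [add_zero] at h2
  exact tendsto_of_tendsto_of_tendsto_of_le_of_le tendsto_const_nhds h2 (fun _ => zero_le)
    fun n => eLpNorm_add_le (hAm n) (hBm n) (by norm_num)

/-- Dominated convergence in `L²` for a product with bounded factors tending to zero. -/
theorem tendsto_eLpNorm_smul_of_bounded {α F : Type*} [MeasurableSpace α] {μ : Measure α}
    [NormedAddCommGroup F] [NormedSpace ℝ F] {G : α → F} (hG : MemLp G 2 μ) {b : ℕ → α → ℝ}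
    (hbm : ∀ n, AEStronglyMeasurable (b n) μ) (hb : ∀ n x, |b n x| ≤ 1)
    (hlim : ∀ᵐ x ∂μ, Tendsto (fun n => b n x) atTop (𝓝 0)) :
    Tendsto (fun n => eLpNorm (fun x => b n x • G x) 2 μ) atTop (𝓝 0) := by
  have h2 : (2 : ℝ≥0∞) ≠ 0 := by norm_num
  have h2' : (2 : ℝ≥0∞) ≠ ⊤ := by norm_num
  have key : Tendsto (fun n => ∫⁻ x, ‖b n x • G x‖ₑ ^ (2 : ℝ) ∂μ) atTop (𝓝 (∫⁻ _, 0 ∂μ)) := by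
    refine tendsto_lintegral_of_dominated_convergence' (fun x => ‖G x‖ₑ ^ (2 : ℝ)) ?_ ?_ ?_ ?_
    · intro n
      exact ((hbm n).smul hG.1).enorm.pow_const _
    · intro n
      refine Eventually.of_forall fun x => ?_
      dsimp only
      gcongr
      rw [enorm_smul]
      calc ‖b n x‖ₑ * ‖G x‖ₑ ≤ 1 * ‖G x‖ₑ := by
            gcongr
            rw [← ofReal_norm, Real.norm_eq_abs]
            simpa using ENNReal.ofReal_le_ofReal (hb n x)
        _ = _ := one_mul _
    · have := lintegral_rpow_enorm_lt_top_of_eLpNorm_lt_top h2 h2' hG.2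
      simpa using this.ne
    · filter_upwards [hlim] with x hx
      have h3 : Tendsto (fun n => b n x • G x) atTop (𝓝 0) := by
        simpa using hx.smul_const (G x)
      have h4 := (ENNReal.continuous_rpow_const (y := (2 : ℝ))).tendsto 0 |>.comp
        (by simpa using (continuous_enorm.tendsto (0 : F)).comp h3)
      simpa [Function.comp_def] using h4
  have e : ∀ n, eLpNorm (fun x => b n x • G x) 2 μ =
      (∫⁻ x, ‖b n x • G x‖ₑ ^ (2 : ℝ) ∂μ) ^ (1 / (2 : ℝ)) := by
    intro n
    rw [eLpNorm_eq_lintegral_rpow_enorm_toReal h2 h2']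
    simp
  simp only [e]
  have := (ENNReal.continuous_rpow_const (y := 1 / (2 : ℝ))).tendsto _ |>.comp key
  simpa [Function.comp_def] using this

theorem MeasureTheory.MemLp.integrable_inner_two {α F : Type*} [MeasurableSpace α]
    {μ : Measure α} [NormedAddCommGroup F] [InnerProductSpace ℝ F] {A B : α → F}
    (hA : MemLp A 2 μ) (hB : MemLp B 2 μ) : Integrable (fun x => inner ℝ (A x) (B x)) μ := by
  refine (L2.integrable_inner (𝕜 := ℝ) (hA.toLp A) (hB.toLp B)).congr ?_
  filter_upwards [hA.coeFn_toLp, hB.coeFn_toLp] with x h1 h2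
  rw [h1, h2]

theorem MeasureTheory.MemLp.integrable_mul_two {α : Type*} [MeasurableSpace α]
    {μ : Measure α} {A B : α → ℝ} (hA : MemLp A 2 μ) (hB : MemLp B 2 μ) :
    Integrable (fun x => A x * B x) μ :=
  hA.integrable_mul hB

theorem MeasureTheory.MemLp.ae_norm_le_toReal_eLpNorm {α F : Type*} [MeasurableSpace α]
    {μ : Measure α} [NormedAddCommGroup F] {f : α → F} (hf : MemLp f ∞ μ) :
    ∀ᵐ x ∂μ, ‖f x‖ ≤ (eLpNorm f ∞ μ).toReal := by
  filter_upwards [ae_le_eLpNormEssSup (f := f) (μ := μ)] with x hx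
  rw [← toReal_enorm]
  exact ENNReal.toReal_mono hf.2.ne (by simpa using hx)

/-! ### Gradients of `C¹` functions -/

section Gradient

variable {E : Type*} [NormedAddCommGroup E] [InnerProductSpace ℝ E] [CompleteSpace E]

theorem ContDiff.continuous_gradient {φ : E → ℝ} (h : ContDiff ℝ 1 φ) :
    Continuous (gradient φ) :=
  (InnerProductSpace.toDual ℝ E).symm.continuous.comp (h.continuous_fderiv one_ne_zero)

theorem inner_gradient_eq_fderiv (φ : E → ℝ) (x e : E) :
    inner ℝ (gradient φ x) e = fderiv ℝ φ x e := by
  rw [gradient, InnerProductSpace.toDual_symm_apply]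

theorem gradient_const_mul_sub {φ w : E → ℝ} {x : E} (s : ℝ) (hφ : DifferentiableAt ℝ φ x)
    (hw : DifferentiableAt ℝ w x) :
    gradient (fun y => s * φ y - w y) x = s • gradient φ x - gradient w x := by
  rw [gradient, gradient, gradient, fderiv_fun_sub (hφ.const_mul s) hw, fderiv_const_mul hφ]
  simp

theorem gradient_ramp_comp {φ : E → ℝ} {x : E} (hφ : DifferentiableAt ℝ φ x) :
    gradient (fun y => ramp (φ y)) x = rampDeriv (φ x) • gradient φ x := by
  have := (hasDerivAt_ramp (φ x)).comp_hasFDerivAt x hφ.hasFDerivAt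
  rw [gradient, gradient, HasFDerivAt.fderiv (f := fun y => ramp (φ y)) this]
  simp

theorem gradient_mul_self {φ : E → ℝ} {x : E} (hφ : DifferentiableAt ℝ φ x) :
    gradient (fun y => φ y * φ y) x = (2 * φ x) • gradient φ x := by
  rw [gradient, gradient, fderiv_fun_mul hφ hφ, ← add_smul, ← two_mul]
  simp

end Gradient

/-! ### Approximation by `C¹` functions -/

/-- Continuity is asked only on a compact superset because the radial fields below may be singular
at the origin, which the closed ring avoids. -/
theorem MeasureTheory.memLp_restrict_of_continuousOn {X F : Type*} [TopologicalSpace X]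
    [T2Space X]
    [SecondCountableTopology X] [MeasurableSpace X] [BorelSpace X] {μ : Measure X}
    [IsFiniteMeasureOnCompacts μ] [NormedAddCommGroup F] {K Ω : Set X} (hK : IsCompact K)
    (hΩ : Ω ⊆ K) {f : X → F} (hf : ContinuousOn f K) (p : ℝ≥0∞) :
    MemLp f p (μ.restrict Ω) := by
  obtain ⟨C, hC⟩ := hK.exists_bound_of_continuousOn hf
  have hfin : IsFiniteMeasure (μ.restrict K) := ⟨by simpa using hK.measure_lt_top⟩
  have h : MemLp f p (μ.restrict K) := by
    refine MemLp.of_bound ?_ C ?_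
    · exact hf.aestronglyMeasurable_of_isCompact hK hK.measurableSet
    · exact ae_restrict_of_forall_mem hK.measurableSet hC
  exact h.mono_measure (Measure.restrict_mono_set _ hΩ)

section Approx

variable {E : Type*} [NormedAddCommGroup E] [InnerProductSpace ℝ E] [FiniteDimensional ℝ E]
  [MeasurableSpace E] [BorelSpace E]

/-- The `C¹` functions `φ n` converge to `g`, and their gradients to `G`, in `L²(Ω)`. -/
structure ApproxByC1 (Ω : Set E) (φ : ℕ → E → ℝ) (g : E → ℝ) (G : E → E) : Prop where
  contDiff : ∀ n, ContDiff ℝ 1 (φ n)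
  tendsto : Tendsto (fun n => eLpNorm (fun x => φ n x - g x) 2 (volume.restrict Ω)) atTop (𝓝 0)
  tendsto_gradient :
    Tendsto (fun n => eLpNorm (fun x => gradient (φ n) x - G x) 2 (volume.restrict Ω))
      atTop (𝓝 0)

namespace ApproxByC1

variable {Ω : Set E} {φ : ℕ → E → ℝ} {g : E → ℝ} {G : E → E}

theorem differentiable (h : ApproxByC1 Ω φ g G) (n : ℕ) : Differentiable ℝ (φ n) :=
  (h.contDiff n).differentiable one_ne_zero

theorem memLp (h : ApproxByC1 Ω φ g G) (hΩ : Bornology.IsBounded Ω) (n : ℕ) :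
    MemLp (φ n) 2 (volume.restrict Ω) :=
  memLp_restrict_of_continuousOn hΩ.isCompact_closure subset_closure
    (h.contDiff n).continuous.continuousOn 2

theorem memLp_gradient (h : ApproxByC1 Ω φ g G) (hΩ : Bornology.IsBounded Ω) (n : ℕ) :
    MemLp (gradient (φ n)) 2 (volume.restrict Ω) :=
  memLp_restrict_of_continuousOn hΩ.isCompact_closure subset_closure
    (h.contDiff n).continuous_gradient.continuousOn 2

theorem comp_subseq (h : ApproxByC1 Ω φ g G) {k : ℕ → ℕ} (hk : StrictMono k) :
    ApproxByC1 Ω (fun n => φ (k n)) g G where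
  contDiff n := h.contDiff (k n)
  tendsto := h.tendsto.comp hk.tendsto_atTop
  tendsto_gradient := h.tendsto_gradient.comp hk.tendsto_atTop

theorem const_mul_sub (h : ApproxByC1 Ω φ g G) (s : ℝ) {w : E → ℝ} (hw : ContDiff ℝ 1 w) :
    ApproxByC1 Ω (fun n x => s * φ n x - w x) (fun x => s * g x - w x)
      (fun x => s • G x - gradient w x) where
  contDiff n := (contDiff_const.mul (h.contDiff n)).sub hw
  tendsto := by
    refine tendsto_eLpNorm_zero_of_le |s| h.tendsto fun n => Eventually.of_forall fun x => ?_
    rw [show s * φ n x - w x - (s * g x - w x) = s * (φ n x - g x) by ring, norm_mul,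
      Real.norm_eq_abs s]
  tendsto_gradient := by
    refine tendsto_eLpNorm_zero_of_le |s| h.tendsto_gradient
      fun n => Eventually.of_forall fun x => ?_
    rw [gradient_const_mul_sub s (h.differentiable n x) (hw.differentiable one_ne_zero x),
      sub_sub_sub_cancel_right, ← smul_sub, norm_smul, Real.norm_eq_abs s]

theorem sub {ψ : ℕ → E → ℝ} {q : E → ℝ} {Q : E → E} (hΩ : Bornology.IsBounded Ω)
    (h : ApproxByC1 Ω φ g G) (h' : ApproxByC1 Ω ψ q Q)
    (hg : MemLp g 2 (volume.restrict Ω)) (hG : MemLp G 2 (volume.restrict Ω))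
    (hq : MemLp q 2 (volume.restrict Ω)) (hQ : MemLp Q 2 (volume.restrict Ω)) (s : ℝ) :
    ApproxByC1 Ω (fun n x => φ n x - s * ψ n x) (fun x => g x - s * q x)
      (fun x => G x - s • Q x) where
  contDiff n := (h.contDiff n).sub (contDiff_const.mul (h'.contDiff n))
  tendsto := by
    have h2 : Tendsto (fun n => eLpNorm (fun x => s * (q x - ψ n x)) 2 (volume.restrict Ω))
        atTop (𝓝 0) :=
      tendsto_eLpNorm_zero_of_le |s| h'.tendsto fun n => Eventually.of_forall fun x => by
        rw [norm_mul, norm_sub_rev, Real.norm_eq_abs s]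
    have := tendsto_eLpNorm_zero_of_add (fun n => ((h.memLp hΩ n).sub hg).1)
      (fun n => ((hq.sub (h'.memLp hΩ n)).const_mul s).1) h.tendsto h2
    refine this.congr fun n => eLpNorm_congr_ae (Eventually.of_forall fun x => ?_)
    simp only [Pi.sub_apply]; ring
  tendsto_gradient := by
    have h2 : Tendsto (fun n => eLpNorm (fun x => s • (Q x - gradient (ψ n) x)) 2
        (volume.restrict Ω)) atTop (𝓝 0) :=
      tendsto_eLpNorm_zero_of_le |s| h'.tendsto_gradient
        fun n => Eventually.of_forall fun x => by
          rw [norm_smul, norm_sub_rev, Real.norm_eq_abs s]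
    have := tendsto_eLpNorm_zero_of_add (fun n => ((h.memLp_gradient hΩ n).sub hG).1)
      (fun n => ((hQ.sub (h'.memLp_gradient hΩ n)).const_smul s).1) h.tendsto_gradient h2
    refine this.congr fun n => eLpNorm_congr_ae (Eventually.of_forall fun x => ?_)
    have e2 : gradient (fun y => φ n y - s * ψ n y) x =
        gradient (φ n) x - s • gradient (ψ n) x := by
      rw [gradient, gradient, gradient,
        fderiv_fun_sub (h.differentiable n x) ((h'.differentiable n x).const_mul s),
        fderiv_const_mul (h'.differentiable n x)]
      simp
    simp only [Pi.sub_apply, Pi.smul_apply]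
    rw [e2]; module

/-- The gradient error splits as `ρ'(φₙ) (∇φₙ - G) + (ρ'(φₙ) - ρ'(g)) G`. The first term is
controlled by `ρ' ≤ 1`. The second needs dominated convergence, hence convergence a.e., and this is
what forces the passage to a subsequence. -/
theorem exists_subseq_ramp_comp (hΩ : Bornology.IsBounded Ω) (h : ApproxByC1 Ω φ g G)
    (hg : MemLp g 2 (volume.restrict Ω)) (hG : MemLp G 2 (volume.restrict Ω)) :
    ∃ k : ℕ → ℕ, StrictMono k ∧ ApproxByC1 Ω (fun n x => ramp (φ (k n) x))
      (fun x => ramp (g x)) (fun x => rampDeriv (g x) • G x) := by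
  obtain ⟨k, hk, hae⟩ := (tendstoInMeasure_of_tendsto_eLpNorm two_ne_zero
    (fun n => (h.memLp hΩ n).1) hg.1 h.tendsto).exists_seq_tendsto_ae
  refine ⟨k, hk, fun n => contDiff_ramp.comp (h.contDiff _), ?_, ?_⟩
  · refine tendsto_eLpNorm_zero_of_le 1 (h.comp_subseq hk).tendsto
      fun n => Eventually.of_forall fun x => ?_
    simpa using abs_ramp_sub_le (φ (k n) x) (g x)
  · have hm : ∀ n, AEStronglyMeasurable (fun x => rampDeriv (φ (k n) x)) (volume.restrict Ω) :=
      fun n => (continuous_rampDeriv.comp (h.contDiff _).continuous).aestronglyMeasurable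
    have hm' : AEStronglyMeasurable (fun x => rampDeriv (g x)) (volume.restrict Ω) :=
      continuous_rampDeriv.comp_aestronglyMeasurable hg.1
    have h1 : Tendsto (fun n => eLpNorm (fun x => rampDeriv (φ (k n) x) •
        (gradient (φ (k n)) x - G x)) 2 (volume.restrict Ω)) atTop (𝓝 0) := by
      refine tendsto_eLpNorm_zero_of_le 1 (h.comp_subseq hk).tendsto_gradient
        fun n => Eventually.of_forall fun x => ?_
      rw [norm_smul, Real.norm_eq_abs, abs_of_nonneg (rampDeriv_nonneg _)]
      gcongr
      exact rampDeriv_le_one _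
    have h2 : Tendsto (fun n => eLpNorm (fun x => (rampDeriv (φ (k n) x) - rampDeriv (g x)) •
        G x) 2 (volume.restrict Ω)) atTop (𝓝 0) := by
      refine tendsto_eLpNorm_smul_of_bounded hG (fun n => (hm n).sub hm') (fun n x => ?_) ?_
      · rw [abs_sub_le_iff]
        constructor <;>
        linarith [rampDeriv_nonneg (φ (k n) x), rampDeriv_le_one (φ (k n) x),
          rampDeriv_nonneg (g x), rampDeriv_le_one (g x)]
      · filter_upwards [hae] with x hx
        have := ((continuous_rampDeriv.tendsto (g x)).comp hx).sub_const (rampDeriv (g x))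
        simpa using this
    have := tendsto_eLpNorm_zero_of_add
      (fun n => (hm n).smul ((h.memLp_gradient hΩ (k n)).sub hG).1)
      (fun n => ((hm n).sub hm').smul hG.1) h1 h2
    refine this.congr fun n => eLpNorm_congr_ae (Eventually.of_forall fun x => ?_)
    dsimp only
    simp only [Pi.smul_apply', Pi.sub_apply]
    rw [gradient_ramp_comp (h.differentiable _ x)]
    module

theorem memLp_ramp_comp (hg : MemLp g 2 (volume.restrict Ω)) :
    MemLp (fun x => ramp (g x)) 2 (volume.restrict Ω) :=
  hg.mono (continuous_ramp.comp_aestronglyMeasurable hg.1) (Eventually.of_forall fun x => by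
    simpa [ramp_of_nonpos le_rfl] using abs_ramp_sub_le (g x) 0)

theorem memLp_rampDeriv_smul (hg : MemLp g 2 (volume.restrict Ω))
    (hG : MemLp G 2 (volume.restrict Ω)) :
    MemLp (fun x => rampDeriv (g x) • G x) 2 (volume.restrict Ω) :=
  hG.mono ((continuous_rampDeriv.comp_aestronglyMeasurable hg.1).smul hG.1)
    (Eventually.of_forall fun x => by
      rw [norm_smul, Real.norm_eq_abs, abs_of_nonneg (rampDeriv_nonneg _)]
      exact mul_le_of_le_one_left (norm_nonneg _) (rampDeriv_le_one _))

end ApproxByC1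

end Approx

/-! ### Weak gradients of `L²` limits of `C¹` functions -/

section WeakGradient

variable {N : ℕ} {Ω : Set (EuclideanSpace ℝ (Fin N))}

theorem ContDiff.isWeakGradient_gradient {ψ : EuclideanSpace ℝ (Fin N) → ℝ}
    (hψ : ContDiff ℝ 1 ψ) : IsWeakGradient Ω ψ (gradient ψ) := by
  intro φ hφ hc hs e
  have hφ1 : ContDiff ℝ 1 φ := hφ.of_le (by exact_mod_cast le_top)
  have hφd : Continuous fun x => fderiv ℝ φ x e :=
    (hφ1.continuous_fderiv one_ne_zero).clm_apply continuous_const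
  have hψd : Continuous fun x => fderiv ℝ ψ x e :=
    (hψ.continuous_fderiv one_ne_zero).clm_apply continuous_const
  have hcd : HasCompactSupport fun x => fderiv ℝ φ x e := by
    refine hc.mono' ((Function.support_subset_iff'.2 fun x hx => ?_))
    have : fderiv ℝ φ x = 0 := by
      by_contra hne
      exact hx (support_fderiv_subset ℝ hne)
    simp [this]
  -- Both integrands vanish off `Ω` because `tsupport φ ⊆ Ω`, so integration by parts on the whole
  -- space applies.
  rw [setIntegral_eq_integral_of_forall_compl_eq_zero, setIntegral_eq_integral_of_forall_compl_eq_zero]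
  · have := integral_mul_fderiv_eq_neg_fderiv_mul_of_integrable (f := ψ) (g := φ) (v := e)
      (μ := volume)
      ((hψd.mul hφ1.continuous).integrable_of_hasCompactSupport hc.mul_left)
      ((hψ.continuous.mul hφd).integrable_of_hasCompactSupport hcd.mul_left)
      ((hψ.continuous.mul hφ1.continuous).integrable_of_hasCompactSupport hc.mul_left)
      (fun x _ => hψ.differentiable one_ne_zero x) (fun x _ => hφ1.differentiable one_ne_zero x)
    rw [this]
    congr 2
    ext x
    rw [inner_gradient_eq_fderiv, mul_comm]
  · intro x hx
    rw [image_eq_zero_of_notMem_tsupport fun h => hx (hs h), zero_mul]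
  · intro x hx
    have : fderiv ℝ φ x = 0 := by
      by_contra hne
      exact hx (hs (support_fderiv_subset ℝ hne))
    simp [this]

/-- For a fixed test function both sides of the defining identity are continuous under `L²`
convergence. -/
theorem ApproxByC1.isWeakGradient (hΩ : Bornology.IsBounded Ω)
    {φ : ℕ → EuclideanSpace ℝ (Fin N) → ℝ} {g : EuclideanSpace ℝ (Fin N) → ℝ}
    {G : EuclideanSpace ℝ (Fin N) → EuclideanSpace ℝ (Fin N)} (h : ApproxByC1 Ω φ g G)
    (hg : MemLp g 2 (volume.restrict Ω)) (hG : MemLp G 2 (volume.restrict Ω)) :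
    IsWeakGradient Ω g G := by
  intro η hη hc hs e
  have hη1 : ContDiff ℝ 1 η := hη.of_le (by exact_mod_cast le_top)
  have hηd : Continuous fun x => fderiv ℝ η x e :=
    (hη1.continuous_fderiv one_ne_zero).clm_apply continuous_const
  have m1 : MemLp (fun x => fderiv ℝ η x e) 2 (volume.restrict Ω) :=
    memLp_restrict_of_continuousOn hΩ.isCompact_closure subset_closure hηd.continuousOn 2
  have m2 : MemLp (fun x => η x • e) 2 (volume.restrict Ω) :=
    memLp_restrict_of_continuousOn hΩ.isCompact_closure subset_closure
      (hη1.continuous.smul continuous_const).continuousOn 2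
  have l1 := tendsto_integral_const_mul_of_tendsto_eLpNorm m1 hg (h.memLp hΩ) h.tendsto
  have l2 := (tendsto_integral_inner_of_tendsto_eLpNorm m2 (fun _ => m2) hG
    (h.memLp_gradient hΩ) (by simp) h.tendsto_gradient).neg
  have e1 : ∀ n, ∫ x in Ω, fderiv ℝ η x e * φ n x =
      - ∫ x in Ω, inner ℝ (η x • e) (gradient (φ n) x) := by
    intro n
    have := (h.contDiff n).isWeakGradient_gradient (Ω := Ω) η hη hc hs e
    simpa only [inner_smul_left, mul_comm (φ n _), real_inner_comm, RCLike.conj_to_real]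
      using this
  simp only [e1] at l1
  have := tendsto_nhds_unique l1 l2
  simpa only [inner_smul_left, mul_comm (g _), real_inner_comm, RCLike.conj_to_real]
      using this

end WeakGradient

/-! ### Integration in polar coordinates -/

/-- The homeomorphism of the punctured space with sphere times half-line carries `μ` to a product
measure with radial density `r ^ (n - 1)`; the rest is Fubini. -/
theorem integral_eq_integral_toSphere {E F : Type*} [NormedAddCommGroup E] [NormedSpace ℝ E]
    [MeasurableSpace E] [BorelSpace E] [FiniteDimensional ℝ E] [Nontrivial E]
    [NormedAddCommGroup F] [NormedSpace ℝ F] (μ : Measure E) [μ.IsAddHaarMeasure] {f : E → F}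
    (hf : Integrable f μ) :
    ∫ x, f x ∂μ = ∫ ω : sphere (0 : E) 1,
      (∫ r in Ioi (0 : ℝ), r ^ (Module.finrank ℝ E - 1) • f (r • (ω : E))) ∂μ.toSphere := by
  have hmp := μ.measurePreserving_homeomorphUnitSphereProd
  set n := Module.finrank ℝ E - 1
  let g : sphere (0 : E) 1 × Ioi (0 : ℝ) → F := fun z => f ((z.2 : ℝ) • (z.1 : E))
  have hg : ∀ x : ({(0)}ᶜ : Set E), g (homeomorphUnitSphereProd E x) = f x := by
    intro x
    have hx : ‖(x : E)‖ ≠ 0 := norm_ne_zero_iff.2 x.2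
    simp [g, smul_smul, mul_inv_cancel₀ hx]
  have hemb := (homeomorphUnitSphereProd E).measurableEmbedding
  have hint : Integrable g (μ.toSphere.prod (.volumeIoiPow n)) := by
    rw [← hmp.integrable_comp_emb hemb]
    have : g ∘ homeomorphUnitSphereProd E = f ∘ (↑) := funext hg
    rw [this]
    have h0 : IntegrableOn f ({(0)}ᶜ : Set E) μ := hf.integrableOn
    exact (integrableOn_iff_comap_subtypeVal (measurableSet_singleton _).compl).1 h0
  calc
    ∫ x, f x ∂μ = ∫ x : ({(0)}ᶜ : Set E), f x ∂(μ.comap (↑)) := by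
      rw [integral_subtype_comap (measurableSet_singleton _).compl fun x ↦ f x,
        restrict_compl_singleton]
    _ = ∫ z, g z ∂μ.toSphere.prod (.volumeIoiPow n) := by
      rw [← hmp.integral_comp hemb g]
      exact integral_congr_ae (Eventually.of_forall fun x => (hg x).symm)
    _ = ∫ ω, ∫ r, g (ω, r) ∂.volumeIoiPow n ∂μ.toSphere := integral_prod _ hint
    _ = _ := by
      congr 1
      ext ω
      simp only [Measure.volumeIoiPow, ENNReal.ofReal]
      rw [integral_withDensity_eq_integral_smul,
        integral_subtype_comap measurableSet_Ioi
          fun a ↦ Real.toNNReal (a ^ n) • f (a • (ω : E)),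
        setIntegral_congr_fun measurableSet_Ioi fun x hx ↦ ?_]
      · rw [NNReal.smul_def, Real.coe_toNNReal _ (pow_nonneg hx.out.le _)]
      · exact (measurable_subtype_coe.pow_const _).real_toNNReal

/-! ### The divergence theorem for radial vector fields on a ring -/

section Ring

variable {N : ℕ} {R₀ R₁ : ℝ}

theorem isOpen_openRing : IsOpen (openRing N R₀ R₁) := isOpen_ball.sdiff isClosed_closedBall

theorem measurableSet_openRing : MeasurableSet (openRing N R₀ R₁) :=
  isOpen_openRing.measurableSet

theorem mem_openRing {x : EuclideanSpace ℝ (Fin N)} :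
    x ∈ openRing N R₀ R₁ ↔ R₀ < ‖x‖ ∧ ‖x‖ < R₁ := by
  simp [openRing, and_comm]

theorem isBounded_openRing : Bornology.IsBounded (openRing N R₀ R₁) :=
  isBounded_ball.subset sdiff_subset

theorem isCompact_closedRing :
    IsCompact (closedBall 0 R₁ \ ball 0 R₀ : Set (EuclideanSpace ℝ (Fin N))) :=
  (isCompact_closedBall _ _).diff isOpen_ball

theorem openRing_subset_closedRing :
    openRing N R₀ R₁ ⊆ closedBall 0 R₁ \ ball 0 R₀ :=
  sdiff_subset_sdiff ball_subset_closedBall ball_subset_closedBall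

instance isFiniteMeasure_restrict_openRing :
    IsFiniteMeasure (volume.restrict (openRing N R₀ R₁)) :=
  ⟨by simpa using isBounded_openRing.measure_lt_top⟩

instance isFiniteMeasure_sphereMeasure (N : ℕ) (R : ℝ) : IsFiniteMeasure (sphereMeasure N R) := by
  unfold sphereMeasure
  constructor
  rw [Measure.smul_apply, smul_eq_mul]
  exact ENNReal.mul_lt_top ENNReal.ofReal_lt_top (measure_lt_top _ _)

theorem integral_sphereMeasure {R : ℝ} (hR : 0 ≤ R) {f : EuclideanSpace ℝ (Fin N) → ℝ}
    (hf : Continuous f) :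
    ∫ x, f x ∂sphereMeasure N R = R ^ (N - 1) *
      ∫ ω : sphere (0 : EuclideanSpace ℝ (Fin N)) 1, f (R • (ω : EuclideanSpace ℝ (Fin N)))
        ∂(volume : Measure (EuclideanSpace ℝ (Fin N))).toSphere := by
  rw [sphereMeasure, integral_smul_measure, integral_map (by fun_prop) hf.aestronglyMeasurable,
    ENNReal.toReal_ofReal (by positivity), smul_eq_mul]

theorem ae_sphereMeasure_norm_eq {R : ℝ} (hR : 0 ≤ R) : ∀ᵐ x ∂sphereMeasure N R, ‖x‖ = R := by
  refine Measure.ae_smul_measure ?_ _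
  rw [ae_map_iff (by fun_prop) (measurableSet_eq_fun (by fun_prop) (by fun_prop))]
  refine Eventually.of_forall fun ω => ?_
  simp [norm_smul, abs_of_nonneg hR]

theorem memLp_sphereMeasure {R : ℝ} (hR : 0 ≤ R) {f : EuclideanSpace ℝ (Fin N) → ℝ}
    (hf : Continuous f) (p : ℝ≥0∞) : MemLp f p (sphereMeasure N R) := by
  have hc : IsCompact (sphere (0 : EuclideanSpace ℝ (Fin N)) R) := isCompact_sphere _ _
  have := memLp_restrict_of_continuousOn (μ := sphereMeasure N R) hc subset_rfl hf.continuousOn p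
  rwa [Measure.restrict_eq_self_of_ae_mem] at this
  filter_upwards [ae_sphereMeasure_norm_eq (N := N) hR] with x hx
  simpa using hx

theorem sphereMeasure_ball_pos {R ρ : ℝ} (hR : 0 < R) (hρ : 0 < ρ)
    {x : EuclideanSpace ℝ (Fin N)} (hx : x ∈ sphere 0 R) : 0 < sphereMeasure N R (ball x ρ) := by
  rw [sphereMeasure, Measure.smul_apply, Measure.map_apply (by fun_prop) measurableSet_ball,
    smul_eq_mul]
  refine ENNReal.mul_pos (by simpa using pow_pos hR _) ?_
  refine IsOpen.measure_ne_zero _ (isOpen_ball.preimage (by fun_prop)) ?_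
  have hx' : ‖x‖ = R := by simpa using hx
  refine ⟨⟨R⁻¹ • x, ?_⟩, ?_⟩
  · rw [mem_sphere_zero_iff_norm, norm_smul, hx', norm_inv, Real.norm_eq_abs, abs_of_pos hR,
      inv_mul_cancel₀ hR.ne']
  · simpa [smul_smul, mul_inv_cancel₀ hR.ne'] using hρ

/-- The radial vector field `x ↦ a(|x|) x / |x|`. -/
noncomputable def radialField (N : ℕ) (a : ℝ → ℝ) (x : EuclideanSpace ℝ (Fin N)) :
    EuclideanSpace ℝ (Fin N) := (a ‖x‖ / ‖x‖) • x

/-- The divergence of the radial vector field with profile `a`, whose derivative is `a'`. -/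
noncomputable def radialDiv (N : ℕ) (a a' : ℝ → ℝ) (x : EuclideanSpace ℝ (Fin N)) : ℝ :=
  a' ‖x‖ + (N - 1) / ‖x‖ * a ‖x‖

theorem continuousOn_radialField (hR₀ : 0 < R₀) {a : ℝ → ℝ} (ha : Continuous a) :
    ContinuousOn (radialField N a) (closedBall 0 R₁ \ ball 0 R₀) := by
  have : ∀ x ∈ (closedBall 0 R₁ \ ball 0 R₀ : Set (EuclideanSpace ℝ (Fin N))), ‖x‖ ≠ 0 := by
    intro x hx
    have : R₀ ≤ ‖x‖ := by simpa using hx.2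
    linarith
  exact ((ha.comp continuous_norm).continuousOn.div continuous_norm.continuousOn this).smul
    continuousOn_id

theorem continuousOn_radialDiv (hR₀ : 0 < R₀) {a a' : ℝ → ℝ} (ha : Continuous a)
    (ha' : Continuous a') : ContinuousOn (radialDiv N a a') (closedBall 0 R₁ \ ball 0 R₀) := by
  have : ∀ x ∈ (closedBall 0 R₁ \ ball 0 R₀ : Set (EuclideanSpace ℝ (Fin N))), ‖x‖ ≠ 0 := by
    intro x hx
    have : R₀ ≤ ‖x‖ := by simpa using hx.2
    linarith
  exact (ha'.comp continuous_norm).continuousOn.add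
    ((continuousOn_const.div continuous_norm.continuousOn this).mul
      (ha.comp continuous_norm).continuousOn)

theorem memLp_radialField (hR₀ : 0 < R₀) {a : ℝ → ℝ} (ha : Continuous a) (p : ℝ≥0∞) :
    MemLp (radialField N a) p (volume.restrict (openRing N R₀ R₁)) :=
  memLp_restrict_of_continuousOn isCompact_closedRing openRing_subset_closedRing
    (continuousOn_radialField hR₀ ha) p

theorem memLp_radialDiv (hR₀ : 0 < R₀) {a a' : ℝ → ℝ} (ha : Continuous a)
    (ha' : Continuous a') (p : ℝ≥0∞) :
    MemLp (radialDiv N a a') p (volume.restrict (openRing N R₀ R₁)) :=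
  memLp_restrict_of_continuousOn isCompact_closedRing openRing_subset_closedRing
    (continuousOn_radialDiv hR₀ ha ha') p

/-- Along each ray the integrand times the Jacobian `r ^ (N - 1)` is the derivative of `a(r) r ^ (N
- 1) ψ(r ω)`. The fundamental theorem of calculus on `[R₀, R₁]`, integrated over `ω`, gives the two
boundary terms. -/
theorem integral_radialField_inner_gradient_add (hN : 1 ≤ N) (hR₀ : 0 < R₀) (hR : R₀ < R₁)
    {a a' : ℝ → ℝ} (ha : ∀ r, HasDerivAt a (a' r) r) (ha' : Continuous a')
    {ψ : EuclideanSpace ℝ (Fin N) → ℝ} (hψ : ContDiff ℝ 1 ψ) :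
    ∫ x in openRing N R₀ R₁,
        (inner ℝ (radialField N a x) (gradient ψ x) + radialDiv N a a' x * ψ x) =
      a R₁ * ∫ x, ψ x ∂sphereMeasure N R₁ - a R₀ * ∫ x, ψ x ∂sphereMeasure N R₀ := by
  have hac : Continuous a := continuous_iff_continuousAt.2 fun r => (ha r).continuousAt
  have : Nontrivial (EuclideanSpace ℝ (Fin N)) := by
    have : Nonempty (Fin N) := ⟨⟨0, hN⟩⟩
    infer_instance
  have hdim : Module.finrank ℝ (EuclideanSpace ℝ (Fin N)) = N := by simp
  set H : EuclideanSpace ℝ (Fin N) → ℝ := fun x =>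
    inner ℝ (radialField N a x) (gradient ψ x) + radialDiv N a a' x * ψ x with hH
  have hHc : ContinuousOn H (closedBall 0 R₁ \ ball 0 R₀) :=
    ((continuousOn_radialField hR₀ hac).inner hψ.continuous_gradient.continuousOn).add
      ((continuousOn_radialDiv hR₀ hac ha').mul hψ.continuous.continuousOn)
  have hHi : IntegrableOn H (openRing N R₀ R₁) := memLp_one_iff_integrable.1
    (memLp_restrict_of_continuousOn isCompact_closedRing openRing_subset_closedRing hHc 1)
  rw [← integral_indicator measurableSet_openRing, integral_eq_integral_toSphere volume
    (hHi.integrable_indicator measurableSet_openRing), hdim,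
    integral_sphereMeasure (hR₀.trans hR).le hψ.continuous,
    integral_sphereMeasure hR₀.le hψ.continuous, ← mul_assoc, ← mul_assoc,
    ← integral_const_mul, ← integral_const_mul, ← integral_sub]
  rotate_left
  · exact (Continuous.integrable_of_hasCompactSupport
      (by have := hψ.continuous; fun_prop) (HasCompactSupport.of_compactSpace _))
  · exact (Continuous.integrable_of_hasCompactSupport
      (by have := hψ.continuous; fun_prop) (HasCompactSupport.of_compactSpace _))
  congr 1
  ext ω
  have hω : ‖(ω : EuclideanSpace ℝ (Fin N))‖ = 1 := by simp
  have hnorm : ∀ r : ℝ, 0 < r → ‖r • (ω : EuclideanSpace ℝ (Fin N))‖ = r := by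
    intro r hr
    rw [norm_smul, hω, Real.norm_eq_abs, abs_of_pos hr, mul_one]
  have hind : ∀ r ∈ Ioi (0 : ℝ), r ^ (N - 1) •
      (openRing N R₀ R₁).indicator H (r • (ω : EuclideanSpace ℝ (Fin N))) =
      (Ioo R₀ R₁).indicator (fun r => r ^ (N - 1) *
        H (r • (ω : EuclideanSpace ℝ (Fin N)))) r := by
    intro r hr
    have hm : r • (ω : EuclideanSpace ℝ (Fin N)) ∈ openRing N R₀ R₁ ↔ r ∈ Ioo R₀ R₁ := by
      rw [mem_openRing, hnorm r hr, mem_Ioo]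
    by_cases h : r ∈ Ioo R₀ R₁
    · rw [indicator_of_mem h, indicator_of_mem (hm.2 h), smul_eq_mul]
    · rw [indicator_of_notMem h, indicator_of_notMem (fun h' => h (hm.1 h')), smul_zero]
  rw [setIntegral_congr_fun measurableSet_Ioi hind, setIntegral_indicator measurableSet_Ioo,
    inter_eq_right.2 (fun r (hr : r ∈ Ioo R₀ R₁) => mem_Ioi.2 (hR₀.trans hr.1)), ← integral_Ioc_eq_integral_Ioo,
    ← intervalIntegral.integral_of_le hR.le]
  have hderiv : ∀ r ∈ uIcc R₀ R₁, HasDerivAt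
      (fun r : ℝ => a r * r ^ (N - 1) * ψ (r • (ω : EuclideanSpace ℝ (Fin N))))
      (r ^ (N - 1) * H (r • (ω : EuclideanSpace ℝ (Fin N)))) r := by
    intro r hr
    rw [uIcc_of_le hR.le] at hr
    have hr0 : 0 < r := hR₀.trans_le hr.1
    have h1 : HasDerivAt (fun r : ℝ => ψ (r • (ω : EuclideanSpace ℝ (Fin N))))
        (fderiv ℝ ψ (r • (ω : EuclideanSpace ℝ (Fin N))) ω) r := by
      have h2 : HasDerivAt (fun r : ℝ => r • (ω : EuclideanSpace ℝ (Fin N))) ω r := by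
        simpa using (hasDerivAt_id r).smul_const (ω : EuclideanSpace ℝ (Fin N))
      exact (hψ.differentiable one_ne_zero _).hasFDerivAt.comp_hasDerivAt r h2
    refine (((ha r).mul (hasDerivAt_pow (N - 1) r)).mul h1).congr_deriv ?_
    simp only [hH, Pi.mul_apply, radialField, radialDiv, hnorm r hr0, inner_smul_left,
      RCLike.conj_to_real]
    rw [real_inner_comm, inner_gradient_eq_fderiv]
    generalize ψ (r • (ω : EuclideanSpace ℝ (Fin N))) = p
    generalize fderiv ℝ ψ (r • (ω : EuclideanSpace ℝ (Fin N))) ω = d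
    obtain ⟨m, rfl⟩ : ∃ m, N = m + 1 := ⟨N - 1, by omega⟩
    -- In dimension one the exponent `N - 1 - 1` truncates to `0`, but its coefficient `N - 1`
    -- vanishes.
    rcases m with _ | m
    · simp; field_simp; ring
    · simp only [Nat.add_sub_cancel]
      push_cast
      field_simp
      ring
  have hcont : ContinuousOn
      (fun r : ℝ => r ^ (N - 1) * H (r • (ω : EuclideanSpace ℝ (Fin N)))) (uIcc R₀ R₁) := by
    refine (continuous_pow _).continuousOn.mul (hHc.comp (by fun_prop) ?_)
    intro r hr
    rw [uIcc_of_le hR.le] at hr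
    have hr0 : 0 < r := hR₀.trans_le hr.1
    simpa [hnorm r hr0] using hr.symm
  rw [intervalIntegral.integral_eq_sub_of_hasDerivAt hderiv hcont.intervalIntegrable]

end Ring

/-! ### The divergence identity in the limit: sign of the flux and uniqueness of traces -/

section RingLimits

variable {N : ℕ} {R₀ R₁ : ℝ}

/-- The outer boundary term tends to `0` and the inner one, `-a(R₀) ∫ ψₙ`, is nonnegative for every
`n`. Only its sign matters, so the approximants need not converge on the inner sphere. -/
theorem ApproxByC1.integral_radialField_add_nonneg (hN : 1 ≤ N) (hR₀ : 0 < R₀) (hR : R₀ < R₁)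
    {a a' : ℝ → ℝ} (ha : ∀ r, HasDerivAt a (a' r) r) (ha' : Continuous a') (haR₀ : a R₀ ≤ 0)
    {ψ : ℕ → EuclideanSpace ℝ (Fin N) → ℝ} {g : EuclideanSpace ℝ (Fin N) → ℝ}
    {G : EuclideanSpace ℝ (Fin N) → EuclideanSpace ℝ (Fin N)}
    (h : ApproxByC1 (openRing N R₀ R₁) ψ g G)
    (hg : MemLp g 2 (volume.restrict (openRing N R₀ R₁)))
    (hG : MemLp G 2 (volume.restrict (openRing N R₀ R₁))) (hpos : ∀ n x, 0 ≤ ψ n x)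
    (htr : Tendsto (fun n => eLpNorm (ψ n) 2 (sphereMeasure N R₁)) atTop (𝓝 0)) :
    0 ≤ (∫ x in openRing N R₀ R₁, inner ℝ (radialField N a x) (G x)) +
      ∫ x in openRing N R₀ R₁, radialDiv N a a' x * g x := by
  have hac : Continuous a := continuous_iff_continuousAt.2 fun r => (ha r).continuousAt
  have mX := memLp_radialField (N := N) (R₁ := R₁) hR₀ hac 2
  have mD := memLp_radialDiv (N := N) (R₁ := R₁) hR₀ hac ha' 2
  have l1 := tendsto_integral_inner_of_tendsto_eLpNorm mX (fun _ => mX) hG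
    (h.memLp_gradient isBounded_openRing) (by simp) h.tendsto_gradient
  have l2 := tendsto_integral_const_mul_of_tendsto_eLpNorm mD hg
    (h.memLp isBounded_openRing) h.tendsto
  have mψ : ∀ n, MemLp (ψ n) 2 (sphereMeasure N R₁) :=
    fun n => memLp_sphereMeasure (hR₀.trans hR).le (h.contDiff n).continuous 2
  have l3 : Tendsto (fun n => ∫ x, ψ n x ∂sphereMeasure N R₁) atTop (𝓝 0) := by
    have := tendsto_integral_const_mul_of_tendsto_eLpNorm
      (memLp_const (1 : ℝ) (μ := sphereMeasure N R₁)) (MemLp.zero (ε := ℝ)) mψ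
      (by simpa using htr)
    simpa using this
  have l4 : Tendsto (fun n => a R₁ * ∫ x, ψ n x ∂sphereMeasure N R₁) atTop (𝓝 0) := by
    simpa using l3.const_mul (a R₁)
  refine le_of_tendsto_of_tendsto' l4 (l1.add l2) fun n => ?_
  have hstar := integral_radialField_inner_gradient_add hN hR₀ hR ha ha' (h.contDiff n)
  rw [integral_add (mX.integrable_inner_two (h.memLp_gradient isBounded_openRing n))
    (mD.integrable_mul_two (h.memLp isBounded_openRing n))] at hstar
  rw [hstar]
  have h0 : 0 ≤ ∫ x, ψ n x ∂sphereMeasure N R₀ := integral_nonneg (hpos n)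
  nlinarith

/-- Apply the divergence identity to `θₙ²` with the profile `R₁ - r`, which removes the outer
sphere. It expresses `(R₁ - R₀) ∫ θₙ²` over the inner sphere through interior integrals that tend to
`0`, while `∫ θₙ²` tends to `∫ τ²`. -/
theorem ApproxByC1.ae_sphereMeasure_eq_zero (hN : 1 ≤ N) (hR₀ : 0 < R₀) (hR : R₀ < R₁)
    {θ : ℕ → EuclideanSpace ℝ (Fin N) → ℝ} {g : EuclideanSpace ℝ (Fin N) → ℝ}
    {G : EuclideanSpace ℝ (Fin N) → EuclideanSpace ℝ (Fin N)}
    (h : ApproxByC1 (openRing N R₀ R₁) θ g G)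
    (hg : ∀ᵐ x ∂volume.restrict (openRing N R₀ R₁), g x = 0)
    (hG : ∀ᵐ x ∂volume.restrict (openRing N R₀ R₁), G x = 0)
    {τ : EuclideanSpace ℝ (Fin N) → ℝ} (hτ : MemLp τ 2 (sphereMeasure N R₀))
    (htr : Tendsto (fun n => eLpNorm (fun x => θ n x - τ x) 2 (sphereMeasure N R₀))
      atTop (𝓝 0)) : ∀ᵐ x ∂sphereMeasure N R₀, τ x = 0 := by
  set a : ℝ → ℝ := fun r => R₁ - r with ha_def
  have ha : ∀ r, HasDerivAt a ((fun _ => -1 : ℝ → ℝ) r) r := fun r => by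
    simpa [ha_def] using (hasDerivAt_id r).const_sub R₁
  have hac : Continuous a := by fun_prop
  have ha' : Continuous (fun _ => -1 : ℝ → ℝ) := continuous_const
  have t0 : Tendsto (fun n => eLpNorm (θ n) 2 (volume.restrict (openRing N R₀ R₁)))
      atTop (𝓝 0) := by
    refine h.tendsto.congr fun n => eLpNorm_congr_ae ?_
    filter_upwards [hg] with x hx
    simp [hx]
  have t1 : Tendsto (fun n => eLpNorm (gradient (θ n)) 2 (volume.restrict (openRing N R₀ R₁)))
      atTop (𝓝 0) := by
    refine h.tendsto_gradient.congr fun n => eLpNorm_congr_ae ?_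
    filter_upwards [hG] with x hx
    simp [hx]
  obtain ⟨C, hC⟩ := (isCompact_closedRing (N := N) (R₀ := R₀)
    (R₁ := R₁)).exists_bound_of_continuousOn (continuousOn_radialField hR₀ hac)
  obtain ⟨D, hD⟩ := (isCompact_closedRing (N := N) (R₀ := R₀)
    (R₁ := R₁)).exists_bound_of_continuousOn (continuousOn_radialDiv hR₀ hac ha')
  have mX : ∀ n, MemLp (fun x => (2 * θ n x) • radialField N a x) 2
      (volume.restrict (openRing N R₀ R₁)) := fun n =>
    memLp_restrict_of_continuousOn isCompact_closedRing openRing_subset_closedRing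
      ((continuous_const.mul (h.contDiff n).continuous).continuousOn.smul
        (continuousOn_radialField hR₀ hac)) 2
  have mD : ∀ n, MemLp (fun x => radialDiv N a (fun _ => -1) x * θ n x) 2
      (volume.restrict (openRing N R₀ R₁)) := fun n =>
    memLp_restrict_of_continuousOn isCompact_closedRing openRing_subset_closedRing
      ((continuousOn_radialDiv hR₀ hac ha').mul (h.contDiff n).continuous.continuousOn) 2
  have z1 : MemLp (fun _ => (0 : EuclideanSpace ℝ (Fin N))) 2
      (volume.restrict (openRing N R₀ R₁)) := memLp_const 0
  have z2 : MemLp (fun _ => (0 : ℝ)) 2 (volume.restrict (openRing N R₀ R₁)) := memLp_const 0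
  have l1 := tendsto_integral_inner_of_tendsto_eLpNorm z1 mX z1 (h.memLp_gradient isBounded_openRing)
    (tendsto_eLpNorm_zero_of_le (2 * C) t0 fun n =>
      ae_restrict_of_forall_mem measurableSet_openRing fun x hx => by
        have := hC x (openRing_subset_closedRing hx)
        simp only [sub_zero, norm_smul, norm_mul, Real.norm_ofNat]
        nlinarith [norm_nonneg (θ n x)]) (by simpa using t1)
  have l2 := tendsto_integral_mul_of_tendsto_eLpNorm z2 mD z2 (h.memLp isBounded_openRing)
    (tendsto_eLpNorm_zero_of_le D t0 fun n =>
      ae_restrict_of_forall_mem measurableSet_openRing fun x hx => by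
        have := hD x (openRing_subset_closedRing hx)
        simp only [sub_zero, norm_mul]
        gcongr) (by simpa using t0)
  have mθ : ∀ n, MemLp (θ n) 2 (sphereMeasure N R₀) :=
    fun n => memLp_sphereMeasure hR₀.le (h.contDiff n).continuous 2
  have l3 := tendsto_integral_mul_of_tendsto_eLpNorm hτ mθ hτ mθ htr htr
  have hstar : ∀ n, (∫ x in openRing N R₀ R₁,
      inner ℝ ((2 * θ n x) • radialField N a x) (gradient (θ n) x)) +
      (∫ x in openRing N R₀ R₁, radialDiv N a (fun _ => -1) x * θ n x * θ n x) =
      - (R₁ - R₀) * ∫ x, θ n x * θ n x ∂sphereMeasure N R₀ := by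
    intro n
    have := integral_radialField_inner_gradient_add hN hR₀ hR ha ha'
      ((h.contDiff n).mul (h.contDiff n))
    rw [← integral_add ((mX n).integrable_inner_two (h.memLp_gradient isBounded_openRing n))
      ((mD n).integrable_mul_two (h.memLp isBounded_openRing n))]
    simp only [ha_def, sub_self, zero_mul, zero_sub, ← neg_mul] at this
    rw [← this]
    congr 1
    ext x
    rw [gradient_mul_self (h.differentiable n x), inner_smul_right, inner_smul_left, mul_assoc]
    simp [ha_def]
  have hlim := tendsto_nhds_unique (l1.add l2) ((l3.const_mul (-(R₁ - R₀))).congr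
    fun n => (hstar n).symm)
  have hz : ∫ x, τ x * τ x ∂sphereMeasure N R₀ = 0 := by
    have h1 : (R₀ - R₁) ≠ 0 := (sub_neg.2 hR).ne
    simpa [h1] using hlim
  rw [integral_eq_zero_iff_of_nonneg (fun x => mul_self_nonneg _) (hτ.integrable_mul_two hτ)] at hz
  filter_upwards [hz] with x hx
  simpa using hx

end RingLimits

/-! ### Truncated test functions and the comparison principle -/

section Comparison

variable {N : ℕ} {R₀ R₁ : ℝ}

theorem SobolevH1.HasTraceOnSphere.exists_approx {Ω : Set (EuclideanSpace ℝ (Fin N))}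
    {u : SobolevH1 Ω} {R : ℝ} {τ : EuclideanSpace ℝ (Fin N) → ℝ} (h : u.HasTraceOnSphere R τ) :
    ∃ φ, ApproxByC1 Ω φ u.toFun u.grad ∧
      Tendsto (fun n => eLpNorm (fun x => φ n x - τ x) 2 (sphereMeasure N R)) atTop (𝓝 0) := by
  obtain ⟨-, φ, h1, h2, h3, h4⟩ := h
  exact ⟨φ, ⟨h1, h2, h3⟩, h4⟩

theorem SobolevH1.memLp_const_mul_sub {Ω : Set (EuclideanSpace ℝ (Fin N))}
    (hΩ : Bornology.IsBounded Ω) (u : SobolevH1 Ω) (s : ℝ) {w : EuclideanSpace ℝ (Fin N) → ℝ}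
    (hw : Continuous w) : MemLp (fun x => s * u.toFun x - w x) 2 (volume.restrict Ω) :=
  (u.memLp.const_mul s).sub
    (memLp_restrict_of_continuousOn hΩ.isCompact_closure subset_closure hw.continuousOn 2)

theorem SobolevH1.memLp_const_smul_grad_sub {Ω : Set (EuclideanSpace ℝ (Fin N))}
    (hΩ : Bornology.IsBounded Ω) (u : SobolevH1 Ω) (s : ℝ) {w : EuclideanSpace ℝ (Fin N) → ℝ}
    (hw : ContDiff ℝ 1 w) :
    MemLp (fun x => s • u.grad x - gradient w x) 2 (volume.restrict Ω) :=
  (u.memLp_grad.const_smul s).sub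
    (memLp_restrict_of_continuousOn hΩ.isCompact_closure subset_closure
      hw.continuous_gradient.continuousOn 2)

/-- The perturbation `u - s ramp (s u - w)` of `u ∈ H¹(Ω)`. -/
noncomputable def SobolevH1.subRamp {Ω : Set (EuclideanSpace ℝ (Fin N))}
    (hΩ : Bornology.IsBounded Ω) (u : SobolevH1 Ω)
    (s : ℝ) {w : EuclideanSpace ℝ (Fin N) → ℝ} (hw : ContDiff ℝ 1 w)
    (hu : ∃ φ, ApproxByC1 Ω φ u.toFun u.grad) : SobolevH1 Ω where
  toFun x := u.toFun x - s * ramp (s * u.toFun x - w x)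
  grad x := u.grad x - s • rampDeriv (s * u.toFun x - w x) • (s • u.grad x - gradient w x)
  memLp := u.memLp.sub ((ApproxByC1.memLp_ramp_comp
    (u.memLp_const_mul_sub hΩ s hw.continuous)).const_mul s)
  memLp_grad := u.memLp_grad.sub ((ApproxByC1.memLp_rampDeriv_smul
    (u.memLp_const_mul_sub hΩ s hw.continuous) (u.memLp_const_smul_grad_sub hΩ s hw)).const_smul s)
  isWeakGradient := by
    have m1 := u.memLp_const_mul_sub hΩ s hw.continuous
    have m2 := u.memLp_const_smul_grad_sub hΩ s hw
    obtain ⟨φ, hφ⟩ := hu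
    obtain ⟨k, hk, hK⟩ := (hφ.const_mul_sub s hw).exists_subseq_ramp_comp hΩ m1 m2
    have m3 := ApproxByC1.memLp_ramp_comp m1
    have m4 := ApproxByC1.memLp_rampDeriv_smul m1 m2
    exact ((hφ.comp_subseq hk).sub hΩ hK u.memLp u.memLp_grad m3 m4 s).isWeakGradient hΩ
      (u.memLp.sub (m3.const_mul s)) (u.memLp_grad.sub (m4.const_smul s))

/-- Since `ramp` is 1-Lipschitz, truncating the approximants of `u` preserves their convergence on
the sphere. -/
theorem SobolevH1.hasTraceOnSphere_subRamp {Ω : Set (EuclideanSpace ℝ (Fin N))}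
    (hΩ : Bornology.IsBounded Ω) (u : SobolevH1 Ω)
    (s : ℝ) {w : EuclideanSpace ℝ (Fin N) → ℝ} (hw : ContDiff ℝ 1 w)
    (hu : ∃ φ, ApproxByC1 Ω φ u.toFun u.grad) {R : ℝ} (hR : 0 ≤ R)
    {τ : EuclideanSpace ℝ (Fin N) → ℝ} (h : u.HasTraceOnSphere R τ) :
    (u.subRamp hΩ s hw hu).HasTraceOnSphere R (fun x => τ x - s * ramp (s * τ x - w x)) := by
  have m1 := u.memLp_const_mul_sub hΩ s hw.continuous
  have m2 := u.memLp_const_smul_grad_sub hΩ s hw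
  have mτ : MemLp (fun x => s * τ x - w x) 2 (sphereMeasure N R) :=
    (h.1.const_mul s).sub (memLp_sphereMeasure hR hw.continuous 2)
  obtain ⟨φ, hφ, htr⟩ := h.exists_approx
  obtain ⟨k, hk, hK⟩ := (hφ.const_mul_sub s hw).exists_subseq_ramp_comp hΩ m1 m2
  have hsub := (hφ.comp_subseq hk).sub hΩ hK u.memLp u.memLp_grad
    (ApproxByC1.memLp_ramp_comp m1) (ApproxByC1.memLp_rampDeriv_smul m1 m2) s
  refine ⟨h.1.sub (MemLp.const_mul ?_ s), _, hsub.contDiff, hsub.tendsto,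
    hsub.tendsto_gradient, ?_⟩
  · exact mτ.mono (continuous_ramp.comp_aestronglyMeasurable mτ.1) (Eventually.of_forall fun x => by
      simpa [ramp_of_nonpos le_rfl] using abs_ramp_sub_le (s * τ x - w x) 0)
  · refine tendsto_eLpNorm_zero_of_le (1 + |s| * |s|) (htr.comp hk.tendsto_atTop)
      fun n => Eventually.of_forall fun x => ?_
    have h1 := abs_ramp_sub_le (s * φ (k n) x - w x) (s * τ x - w x)
    rw [sub_sub_sub_cancel_right, ← mul_sub, abs_mul] at h1
    have h2 : φ (k n) x - s * ramp (s * φ (k n) x - w x) -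
        (τ x - s * ramp (s * τ x - w x)) = (φ (k n) x - τ x) -
        s * (ramp (s * φ (k n) x - w x) - ramp (s * τ x - w x)) := by ring
    rw [h2]
    calc ‖φ (k n) x - τ x - s * (ramp (s * φ (k n) x - w x) - ramp (s * τ x - w x))‖
        ≤ ‖φ (k n) x - τ x‖ + |s| *
          |ramp (s * φ (k n) x - w x) - ramp (s * τ x - w x)| := by
          rw [← abs_mul]; exact norm_sub_le _ _
      _ ≤ ‖φ (k n) x - τ x‖ + |s| * (|s| * |φ (k n) x - τ x|) := by gcongr
      _ = _ := by simp only [Real.norm_eq_abs]; ring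

/-- On the outer sphere the argument of `ramp` is `-w ≤ 0`. On the inner one, for `s = 1` the amount
subtracted is at most `(τ - w)⁺ ≤ τ`, and for `s = -1` a nonnegative amount is added. -/
theorem subRamp_mem_admissibleSet (hR₀ : 0 < R₀) (hR : R₀ < R₁)
    {u : SobolevH1 (openRing N R₀ R₁)} (hu : u ∈ admissibleSet N R₀ R₁) {s : ℝ}
    (hs : s = 1 ∨ s = -1) {w : EuclideanSpace ℝ (Fin N) → ℝ} (hw : ContDiff ℝ 1 w)
    (hw₀ : ∀ x, ‖x‖ = R₀ → 0 ≤ w x) (hw₁ : ∀ x, ‖x‖ = R₁ → 0 ≤ w x)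
    (ha : ∃ φ, ApproxByC1 (openRing N R₀ R₁) φ u.toFun u.grad) :
    u.subRamp isBounded_openRing s hw ha ∈ admissibleSet N R₀ R₁ := by
  obtain ⟨⟨τ₁, hτ₁, h₁⟩, τ₀, hτ₀, h₀⟩ := hu
  refine ⟨⟨_, u.hasTraceOnSphere_subRamp isBounded_openRing s hw ha (hR₀.trans hR).le hτ₁, ?_⟩,
    _, u.hasTraceOnSphere_subRamp isBounded_openRing s hw ha hR₀.le hτ₀, ?_⟩
  · filter_upwards [h₁, ae_sphereMeasure_norm_eq (N := N) (hR₀.trans hR).le] with x hx hxR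
    rw [hx, ramp_of_nonpos (by simpa using hw₁ x hxR)]
    simp
  · filter_upwards [h₀, ae_sphereMeasure_norm_eq (N := N) hR₀.le] with x hx hxR
    have hwx := hw₀ x hxR
    rcases hs with rfl | rfl
    · have h2 : max (1 * τ₀ x - w x) 0 ≤ τ₀ x := max_le (by linarith) hx
      linarith [ramp_le_max (1 * τ₀ x - w x)]
    · linarith [ramp_nonneg (-1 * τ₀ x - w x)]

/-- Weak comparison principle for the Signorini problem with a radial barrier `w`. -/
theorem IsSignoriniSolution.ae_mul_le (hN : 1 ≤ N) (hR₀ : 0 < R₀) (hR : R₀ < R₁)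
    {f : EuclideanSpace ℝ (Fin N) → ℝ} (hf : MemLp f 2 (volume.restrict (openRing N R₀ R₁)))
    {u : SobolevH1 (openRing N R₀ R₁)} (hu : IsSignoriniSolution f u) {s : ℝ}
    (hs : s = 1 ∨ s = -1) {w : EuclideanSpace ℝ (Fin N) → ℝ} (hw : ContDiff ℝ 1 w)
    (hw₀ : ∀ x, ‖x‖ = R₀ → 0 ≤ w x) (hw₁ : ∀ x, ‖x‖ = R₁ → 0 ≤ w x)
    {a a' : ℝ → ℝ} (ha : ∀ r, HasDerivAt a (a' r) r) (ha' : Continuous a') (haR₀ : a R₀ ≤ 0)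
    (hgrad : ∀ x ∈ openRing N R₀ R₁, gradient w x = radialField N a x)
    (hsgn : ∀ᵐ x ∂volume.restrict (openRing N R₀ R₁),
      (s * f x + radialDiv N a a' x) * ramp (s * u.toFun x - w x) ≤ 0) :
    ∀ᵐ x ∂volume.restrict (openRing N R₀ R₁), s * u.toFun x ≤ w x := by
  have hac : Continuous a := continuous_iff_continuousAt.2 fun r => (ha r).continuousAt
  obtain ⟨hK, hvar⟩ := hu
  obtain ⟨τ₁, hτ₁, hz₁⟩ := hK.1
  obtain ⟨φ, hφ, htr⟩ := hτ₁.exists_approx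
  have hmem := subRamp_mem_admissibleSet hR₀ hR hK hs hw hw₀ hw₁ ⟨φ, hφ⟩
  have hvi := hvar _ hmem
  simp only [SobolevH1.subRamp, sub_sub_cancel_left] at hvi
  have mg := u.memLp_const_mul_sub isBounded_openRing s hw.continuous
  have mG := u.memLp_const_smul_grad_sub isBounded_openRing s hw
  set g : EuclideanSpace ℝ (Fin N) → ℝ := fun x => s * u.toFun x - w x with hg_def
  set G : EuclideanSpace ℝ (Fin N) → EuclideanSpace ℝ (Fin N) :=
    fun x => s • u.grad x - gradient w x with hG_def
  obtain ⟨k, hk, hH⟩ : ∃ k : ℕ → ℕ, StrictMono k ∧ ApproxByC1 (openRing N R₀ R₁)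
      (fun n x => ramp (s * φ (k n) x - w x)) (fun x => ramp (g x))
      (fun x => rampDeriv (g x) • G x) :=
    (hφ.const_mul_sub s hw).exists_subseq_ramp_comp isBounded_openRing mg mG
  have mψ : MemLp (fun x => ramp (g x)) 2 (volume.restrict (openRing N R₀ R₁)) :=
    ApproxByC1.memLp_ramp_comp mg
  have mΨ : MemLp (fun x => rampDeriv (g x) • G x) 2 (volume.restrict (openRing N R₀ R₁)) :=
    ApproxByC1.memLp_rampDeriv_smul mg mG
  have mU : MemLp (fun x => s • u.grad x) 2 (volume.restrict (openRing N R₀ R₁)) :=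
    u.memLp_grad.const_smul s
  have mX := memLp_radialField (N := N) (R₁ := R₁) hR₀ hac 2
  have mD := memLp_radialDiv (N := N) (R₁ := R₁) hR₀ hac ha' 2
  have htr0 : Tendsto (fun n => eLpNorm (fun x => ramp (s * φ (k n) x - w x)) 2
      (sphereMeasure N R₁)) atTop (𝓝 0) := by
    refine tendsto_eLpNorm_zero_of_le |s| (htr.comp hk.tendsto_atTop) fun n => ?_
    filter_upwards [hz₁, ae_sphereMeasure_norm_eq (N := N) (hR₀.trans hR).le] with x hx hxR
    have h1 := abs_ramp_sub_le (s * φ (k n) x - w x) (- w x)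
    have h0 : ramp (- w x) = 0 := ramp_of_nonpos (by simpa using hw₁ x hxR)
    rw [h0, sub_zero] at h1
    simpa [hx, abs_mul] using h1
  -- This is `∫ ∇w · ∇ψ + ∫ Δw ψ ≥ 0` for `ψ = ramp (s u - w)`.
  have hL := hH.integral_radialField_add_nonneg hN hR₀ hR ha ha' haR₀ mψ mΨ
    (fun n x => ramp_nonneg _) htr0
  -- the energy of the truncation vanishes
  have i1 : ∫ x in openRing N R₀ R₁, inner ℝ (s • u.grad x) (rampDeriv (g x) • G x) ≤
      ∫ x in openRing N R₀ R₁, s * f x * ramp (g x) := by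
    have e1 : ∫ x in openRing N R₀ R₁, f x * -(s * ramp (g x)) =
        - ∫ x in openRing N R₀ R₁, s * f x * ramp (g x) := by
      rw [← integral_neg]
      congr 1; ext x; ring
    have e2 : ∫ x in openRing N R₀ R₁, inner ℝ (u.grad x) (-(s • rampDeriv (g x) • G x)) =
        - ∫ x in openRing N R₀ R₁, inner ℝ (s • u.grad x) (rampDeriv (g x) • G x) := by
      rw [← integral_neg]
      congr 1; ext x
      rw [inner_neg_right, inner_smul_right _ _ s, inner_smul_left, RCLike.conj_to_real]
    rw [e1, e2] at hvi
    linarith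
  have i2 : ∫ x in openRing N R₀ R₁, (s * f x + radialDiv N a a' x) * ramp (g x) ≤ 0 :=
    integral_nonpos_of_ae hsgn
  have i3 : ∫ x in openRing N R₀ R₁, inner ℝ (G x) (rampDeriv (g x) • G x) =
      (∫ x in openRing N R₀ R₁, inner ℝ (s • u.grad x) (rampDeriv (g x) • G x)) -
      ∫ x in openRing N R₀ R₁, inner ℝ (radialField N a x) (rampDeriv (g x) • G x) := by
    rw [← integral_sub (mU.integrable_inner_two mΨ)
      (mX.integrable_inner_two mΨ)]
    refine setIntegral_congr_fun measurableSet_openRing fun x hx => ?_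
    simp only [hG_def, hgrad x hx, inner_sub_left]
  have i4 : ∫ x in openRing N R₀ R₁, (s * f x + radialDiv N a a' x) * ramp (g x) =
      (∫ x in openRing N R₀ R₁, s * f x * ramp (g x)) +
      ∫ x in openRing N R₀ R₁, radialDiv N a a' x * ramp (g x) := by
    rw [← integral_add ((hf.const_mul s).integrable_mul_two mψ) (mD.integrable_mul_two mψ)]
    congr 1; ext x; ring
  have i5 : ∫ x in openRing N R₀ R₁, inner ℝ (G x) (rampDeriv (g x) • G x) ≤ 0 := by linarith
  have hnn : ∀ x, 0 ≤ inner ℝ (G x) (rampDeriv (g x) • G x) := fun x => by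
    rw [inner_smul_right]
    exact mul_nonneg (rampDeriv_nonneg _) real_inner_self_nonneg
  -- The nonnegative integrand is `ρ'(g) |G|²`, so a.e. one of the factors `ρ'(g)` and `G` is zero.
  have hΨ : ∀ᵐ x ∂volume.restrict (openRing N R₀ R₁), rampDeriv (g x) • G x = 0 := by
    have := (integral_eq_zero_iff_of_nonneg hnn (mG.integrable_inner_two mΨ)).1
      (le_antisymm i5 (integral_nonneg hnn))
    filter_upwards [this] with x hx
    rw [Pi.zero_apply, inner_smul_right, mul_eq_zero, inner_self_eq_zero] at hx
    rcases hx with hx | hx <;> simp [hx]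
  -- a second radial field shows that the truncation itself vanishes
  have hb : ∀ r : ℝ, HasDerivAt (fun r => R₀ - r) ((fun _ => -1 : ℝ → ℝ) r) r := fun r => by
    simpa using (hasDerivAt_id r).const_sub R₀
  have hL2 := hH.integral_radialField_add_nonneg hN hR₀ hR hb continuous_const (by simp) mψ mΨ
    (fun n x => ramp_nonneg _) htr0
  have mD2 := memLp_radialDiv (N := N) (R₁ := R₁) (a := fun r => R₀ - r)
    (a' := fun _ => -1) hR₀ (by fun_prop) continuous_const 2
  have z1 : ∫ x in openRing N R₀ R₁,
      inner ℝ (radialField N (fun r => R₀ - r) x) (rampDeriv (g x) • G x) = 0 := by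
    refine integral_eq_zero_of_ae ?_
    filter_upwards [hΨ] with x hx
    rw [hx, inner_zero_right, Pi.zero_apply]
  -- The field with profile `R₀ - r` has divergence at most `-1` on the ring. As `∇ψ = 0`, `hL2`
  -- reduces to `0 ≤ ∫ div ψ`, whence `∫ ψ ≤ 0`.
  have hle : ∀ᵐ x ∂volume.restrict (openRing N R₀ R₁),
      ramp (g x) ≤ -(radialDiv N (fun r => R₀ - r) (fun _ => -1) x * ramp (g x)) := by
    refine ae_restrict_of_forall_mem measurableSet_openRing fun x hx => ?_
    rw [mem_openRing] at hx
    have hN' : (1 : ℝ) ≤ N := by exact_mod_cast hN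
    have h1 : ((N : ℝ) - 1) / ‖x‖ * (R₀ - ‖x‖) ≤ 0 :=
      mul_nonpos_of_nonneg_of_nonpos (div_nonneg (by linarith) (norm_nonneg _)) (by linarith)
    have h2 := ramp_nonneg (g x)
    simp only [radialDiv]
    nlinarith
  have hψi : Integrable (fun x => ramp (g x)) (volume.restrict (openRing N R₀ R₁)) :=
    mψ.integrable (by norm_num)
  have hψ0 : ∫ x in openRing N R₀ R₁, ramp (g x) ≤ 0 := by
    have := integral_mono_ae hψi (mD2.integrable_mul_two mψ).neg hle
    simp only [Pi.neg_apply, integral_neg] at this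
    linarith
  have := (integral_eq_zero_iff_of_nonneg (fun x => ramp_nonneg (g x)) hψi).1
    (le_antisymm hψ0 (integral_nonneg fun x => ramp_nonneg (g x)))
  filter_upwards [this] with x hx
  have := nonpos_of_ramp_eq_zero hx
  simp only [hg_def] at this
  linarith

end Comparison

/-! ### Radial barriers -/

section Barrier

theorem hasGradientAt_comp_norm {E : Type*} [NormedAddCommGroup E] [InnerProductSpace ℝ E]
    [CompleteSpace E] {q : ℝ → ℝ} {q' : ℝ} {x : E} (hq : HasDerivAt q q' ‖x‖) (hx : x ≠ 0) :
    HasGradientAt (fun y => q ‖y‖) ((q' / ‖x‖) • x) x := by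
  have hx0 : ‖x‖ ≠ 0 := norm_ne_zero_iff.2 hx
  have h1 : HasFDerivAt (fun y : E => ‖y‖ ^ 2) (2 • innerSL ℝ x) x :=
    (hasStrictFDerivAt_norm_sq x).hasFDerivAt
  have h2 := (Real.hasDerivAt_sqrt (pow_ne_zero 2 hx0)).comp_hasFDerivAt x h1
  have h3 : HasFDerivAt (fun y : E => ‖y‖) ((1 / (2 * ‖x‖)) • (2 • innerSL ℝ x)) x := by
    have e : (Real.sqrt ∘ fun y : E => ‖y‖ ^ 2) = fun y => ‖y‖ := by
      ext y; simp [Real.sqrt_sq (norm_nonneg y)]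
    rwa [e, Real.sqrt_sq (norm_nonneg x)] at h2
  have h4 := hq.comp_hasFDerivAt x h3
  rw [hasGradientAt_iff_hasFDerivAt]
  refine HasFDerivAt.congr_fderiv h4 ?_
  ext y
  simp
  field_simp

theorem hasDerivAt_max_zero_sq (t : ℝ) : HasDerivAt (fun t : ℝ => (max t 0) ^ 2) (2 * max t 0) t := by
  have hne : ∀ y : ℝ, y ≠ 0 → HasDerivAt (fun t : ℝ => (max t 0) ^ 2) (2 * max y 0) y := by
    intro y hy
    rcases lt_or_gt_of_ne hy with hy | hy
    · rw [max_eq_right hy.le, mul_zero]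
      refine (hasDerivAt_const y (0 : ℝ)).congr_of_eventuallyEq ?_
      filter_upwards [Iio_mem_nhds hy] with z hz
      simp [max_eq_right (le_of_lt (mem_Iio.1 hz))]
    · rw [max_eq_left hy.le]
      refine (by simpa using hasDerivAt_pow 2 y :
        HasDerivAt (fun z : ℝ => z ^ 2) (2 * y) y).congr_of_eventuallyEq ?_
      filter_upwards [Ioi_mem_nhds hy] with z hz
      simp [max_eq_left (le_of_lt (mem_Ioi.1 hz))]
  rcases eq_or_ne t 0 with rfl | ht
  · exact hasDerivAt_of_hasDerivAt_of_ne (g := fun t : ℝ => 2 * max t 0) (fun y hy => hne y hy)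
      (by fun_prop) (by fun_prop)
  · exact hne t ht

/-- The barrier `c ((|x| - R)⁺)²`. -/
noncomputable def quadraticBarrier (N : ℕ) (c R : ℝ) (x : EuclideanSpace ℝ (Fin N)) : ℝ :=
  c * (max (‖x‖ - R) 0) ^ 2

variable {N : ℕ} {c R : ℝ}

/-- The denominator is `max ‖x‖ R` instead of `‖x‖` to keep the formula continuous at the origin;
the two differ only where the numerator is zero. -/
theorem hasGradientAt_quadraticBarrier (hR : 0 < R) (x : EuclideanSpace ℝ (Fin N)) :
    HasGradientAt (quadraticBarrier N c R)
      ((c * (2 * max (‖x‖ - R) 0) / max ‖x‖ R) • x) x := by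
  rcases lt_or_ge ‖x‖ R with hx | hx
  · rw [max_eq_right (sub_nonpos.2 hx.le)]
    simp only [mul_zero, zero_div, zero_smul]
    rw [hasGradientAt_iff_hasFDerivAt, map_zero]
    refine (hasFDerivAt_const (0 : ℝ) x).congr_of_eventuallyEq ?_
    filter_upwards [(isOpen_lt continuous_norm continuous_const).mem_nhds hx] with y hy
    simp [quadraticBarrier, le_of_lt (show ‖y‖ < R from hy)]
  · rw [max_eq_left hx]
    have hx0 : x ≠ 0 := norm_pos_iff.1 (hR.trans_le hx)
    have h1 : HasDerivAt (fun r : ℝ => c * (max (r - R) 0) ^ 2)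
        (c * (2 * max (‖x‖ - R) 0)) ‖x‖ := by
      have := (hasDerivAt_max_zero_sq (‖x‖ - R)).comp ‖x‖ ((hasDerivAt_id _).sub_const R)
      rw [mul_one] at this
      exact this.const_mul c
    exact hasGradientAt_comp_norm h1 hx0

theorem contDiff_quadraticBarrier (hR : 0 < R) : ContDiff ℝ 1 (quadraticBarrier N c R) := by
  rw [contDiff_one_iff_fderiv]
  refine ⟨fun x => (hasGradientAt_quadraticBarrier hR x).differentiableAt, ?_⟩
  have : fderiv ℝ (quadraticBarrier N c R) = fun x => InnerProductSpace.toDual ℝ _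
      ((c * (2 * max (‖x‖ - R) 0) / max ‖x‖ R) • x) :=
    funext fun x => (hasGradientAt_quadraticBarrier hR x).hasFDerivAt.fderiv
  rw [this]
  have hc : Continuous fun x : EuclideanSpace ℝ (Fin N) =>
      c * (2 * max (‖x‖ - R) 0) / max ‖x‖ R :=
    Continuous.div (by fun_prop) (by fun_prop) fun x => (hR.trans_le (le_max_right _ _)).ne'
  exact (InnerProductSpace.toDual ℝ _).continuous.comp (hc.smul continuous_id)

end Barrier

/-! ### Boundedness, vanishing trace and quadratic growth -/

section Signorini

variable {N : ℕ} {R₀ R₁ : ℝ}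

/-- Solutions of the Signorini problem with bounded right-hand side are bounded. -/
theorem IsSignoriniSolution.memLp_top (hN : 1 ≤ N) (hR₀ : 0 < R₀) (hR : R₀ < R₁)
    {f : EuclideanSpace ℝ (Fin N) → ℝ} (hf : MemLp f 2 (volume.restrict (openRing N R₀ R₁)))
    (hf' : MemLp f ∞ (volume.restrict (openRing N R₀ R₁)))
    {u : SobolevH1 (openRing N R₀ R₁)} (hu : IsSignoriniSolution f u) :
    MemLp u.toFun ∞ (volume.restrict (openRing N R₀ R₁)) := by
  have hN' : (0 : ℝ) < N := by exact_mod_cast hN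
  obtain ⟨F, hF0, hF⟩ : ∃ F : ℝ, 0 ≤ F ∧
      ∀ᵐ x ∂volume.restrict (openRing N R₀ R₁), |f x| ≤ F :=
    ⟨_, ENNReal.toReal_nonneg, hf'.ae_norm_le_toReal_eLpNorm⟩
  -- The radial solution of `-Δw = F` that is smooth at the origin and vanishes on the outer sphere.
  set q : ℝ → ℝ := fun r => F / (2 * N) * (R₁ ^ 2 - r ^ 2)
  have hq : ∀ r, HasDerivAt q (-(F / N) * r) r := fun r => by
    refine (((hasDerivAt_pow 2 r).const_sub (R₁ ^ 2)).const_mul (F / (2 * N))).congr_deriv ?_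
    field_simp
    norm_num
  have ha : ∀ r : ℝ, HasDerivAt (fun r => -(F / N) * r) ((fun _ => -(F / N) : ℝ → ℝ) r) r :=
    fun r => by simpa using (hasDerivAt_id r).const_mul (-(F / N))
  have hw : ContDiff ℝ 1 (fun x : EuclideanSpace ℝ (Fin N) => q ‖x‖) :=
    contDiff_const.mul (contDiff_const.sub (contDiff_norm_sq ℝ))
  have hqn : ∀ r, 0 ≤ r → r ≤ R₁ → 0 ≤ q r := fun r h0 h1 =>
    mul_nonneg (by positivity) (by nlinarith)
  have key : ∀ s : ℝ, s = 1 ∨ s = -1 →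
      ∀ᵐ x ∂volume.restrict (openRing N R₀ R₁), s * u.toFun x ≤ q ‖x‖ := by
    intro s hs
    refine hu.ae_mul_le hN hR₀ hR hf hs hw ?_ ?_ ha continuous_const ?_ ?_ ?_
    · intro x hx; rw [hx]; exact hqn _ hR₀.le hR.le
    · intro x hx; rw [hx]; exact hqn _ (hR₀.trans hR).le le_rfl
    · have : 0 ≤ F / N * R₀ := by positivity
      linarith
    · intro x hx
      have hx0 : x ≠ 0 := norm_pos_iff.1 (hR₀.trans (mem_openRing.1 hx).1)
      exact (hasGradientAt_comp_norm (hq ‖x‖) hx0).gradient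
    · filter_upwards [hF, ae_restrict_mem measurableSet_openRing] with x hx hxr
      have hx0 : ‖x‖ ≠ 0 := (hR₀.trans (mem_openRing.1 hxr).1).ne'
      refine mul_nonpos_of_nonpos_of_nonneg ?_ (ramp_nonneg _)
      have e : radialDiv N (fun r => -(F / N) * r) (fun _ => -(F / N)) x = -F := by
        simp only [radialDiv]; field_simp; ring
      rw [e]
      have := abs_le.1 hx
      rcases hs with rfl | rfl <;> linarith
  refine memLp_top_of_bound u.memLp.1 (F / (2 * N) * R₁ ^ 2) ?_
  filter_upwards [key 1 (Or.inl rfl), key (-1) (Or.inr rfl)] with x h1 h2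
  have h3 : q ‖x‖ ≤ F / (2 * N) * R₁ ^ 2 :=
    mul_le_mul_of_nonneg_left (by nlinarith [norm_nonneg x]) (by positivity)
  rw [Real.norm_eq_abs, abs_le]
  constructor <;> linarith

/-- The trace on the inner sphere of an admissible function below a `C¹` function that vanishes
on the inner sphere is zero. -/
theorem ae_trace_eq_zero_of_le (hN : 1 ≤ N) (hR₀ : 0 < R₀) (hR : R₀ < R₁)
    {u : SobolevH1 (openRing N R₀ R₁)} (hu : u ∈ admissibleSet N R₀ R₁)
    {w : EuclideanSpace ℝ (Fin N) → ℝ} (hw : ContDiff ℝ 1 w) (hw₀ : ∀ x, ‖x‖ = R₀ → w x = 0)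
    (hle : ∀ᵐ x ∂volume.restrict (openRing N R₀ R₁), u.toFun x ≤ w x)
    {τ : EuclideanSpace ℝ (Fin N) → ℝ} (hτ : u.HasTraceOnSphere R₀ τ) :
    ∀ᵐ x ∂sphereMeasure N R₀, τ x = 0 := by
  obtain ⟨-, τ₀, hτ₀, hnn⟩ := hu
  obtain ⟨φ, hφ, htr⟩ := hτ.exists_approx
  obtain ⟨φ₀, hφ₀, htr₀⟩ := hτ₀.exists_approx
  -- Membership in `K` supplies its own nonnegative trace `τ₀`. It agrees with `τ` because the
  -- difference of the two approximating sequences approximates `u - u = 0`.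
  have h1 : ∀ᵐ x ∂sphereMeasure N R₀, τ x - τ₀ x = 0 := by
    refine (hφ.sub isBounded_openRing hφ₀ u.memLp u.memLp_grad u.memLp u.memLp_grad
      1).ae_sphereMeasure_eq_zero hN hR₀ hR (Eventually.of_forall fun x => by simp)
      (Eventually.of_forall fun x => by simp) (hτ.1.sub hτ₀.1) ?_
    have hneg : Tendsto (fun n => eLpNorm (fun x => τ₀ x - φ₀ n x) 2 (sphereMeasure N R₀))
        atTop (𝓝 0) :=
      tendsto_eLpNorm_zero_of_le 1 htr₀ fun n => Eventually.of_forall fun x => by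
        rw [one_mul, norm_sub_rev]
    have := tendsto_eLpNorm_zero_of_add
      (fun n => ((memLp_sphereMeasure hR₀.le (hφ.contDiff n).continuous 2).sub hτ.1).1)
      (fun n => (hτ₀.1.sub (memLp_sphereMeasure hR₀.le (hφ₀.contDiff n).continuous 2)).1)
      htr hneg
    refine this.congr fun n => eLpNorm_congr_ae (Eventually.of_forall fun x => ?_)
    simp only [Pi.sub_apply]; ring
  have mg := u.memLp_const_mul_sub isBounded_openRing 1 hw.continuous
  have mG := u.memLp_const_smul_grad_sub isBounded_openRing 1 hw
  have mτ : MemLp (fun x => 1 * τ x - w x) 2 (sphereMeasure N R₀) :=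
    (hτ.1.const_mul 1).sub (memLp_sphereMeasure hR₀.le hw.continuous 2)
  obtain ⟨k, hk, hH⟩ :=
    (hφ.const_mul_sub 1 hw).exists_subseq_ramp_comp isBounded_openRing mg mG
  -- This is the trace of `ramp (u - w)`, which vanishes a.e. in the ring together with its
  -- gradient.
  have h2 : ∀ᵐ x ∂sphereMeasure N R₀, ramp (1 * τ x - w x) = 0 := by
    refine hH.ae_sphereMeasure_eq_zero hN hR₀ hR ?_ ?_
      (mτ.mono (continuous_ramp.comp_aestronglyMeasurable mτ.1) (Eventually.of_forall fun x => by
        simpa [ramp_of_nonpos le_rfl] using abs_ramp_sub_le (1 * τ x - w x) 0)) ?_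
    · filter_upwards [hle] with x hx
      exact ramp_of_nonpos (by linarith)
    · filter_upwards [hle] with x hx
      rw [rampDeriv_of_nonpos (by linarith), zero_smul]
    · refine tendsto_eLpNorm_zero_of_le 1 (htr.comp hk.tendsto_atTop)
        fun n => Eventually.of_forall fun x => ?_
      have := abs_ramp_sub_le (1 * φ (k n) x - w x) (1 * τ x - w x)
      simpa using this
  filter_upwards [h1, h2, hnn, ae_sphereMeasure_norm_eq (N := N) hR₀.le] with x h1 h2 h3 hx
  have := nonpos_of_ramp_eq_zero h2
  rw [hw₀ x hx] at this
  linarith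

/-- Balls centred on the sphere have positive surface measure, so a trace that is zero a.e. has no
positive lower bound on any of them. -/
theorem coincidenceSet_eq_sphere {R : ℝ} (hR : 0 < R) {τ : EuclideanSpace ℝ (Fin N) → ℝ}
    (hτ : ∀ᵐ x ∂sphereMeasure N R, τ x = 0) : coincidenceSet R τ = sphere 0 R := by
  refine Subset.antisymm (fun x hx => hx.1) fun x hx => ⟨hx, ?_⟩
  rintro ⟨ρ, hρ, δ, hδ, h⟩
  have h0 : ∀ᵐ y ∂sphereMeasure N R, y ∉ ball x ρ := by
    filter_upwards [h, hτ] with y h1 h2 hy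
    have := h1 hy
    linarith
  have h1 := sphereMeasure_ball_pos hR hρ hx
  rw [ae_iff] at h0
  simp only [not_not, ofPred_mem_eq] at h0
  exact h1.ne' h0

/-- Quadratic growth from the inner sphere of solutions of the Signorini problem. -/
theorem IsSignoriniSolution.ae_le_quadraticBarrier (hN : 1 ≤ N) (hR₀ : 0 < R₀) (hR : R₀ < R₁)
    {f : EuclideanSpace ℝ (Fin N) → ℝ} (hf : MemLp f 2 (volume.restrict (openRing N R₀ R₁)))
    {u : SobolevH1 (openRing N R₀ R₁)} (hu : IsSignoriniSolution f u)
    {ε Rε c M : ℝ}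
    (hfε : ∀ᵐ x ∂volume.restrict (openRing N R₀ R₁), ‖x‖ < Rε → f x ≤ -ε)
    (hc : 0 < c) (hcε : c ≤ ε / 2 * (1 + ((N : ℝ) - 1) / R₀ * (Rε - R₀))⁻¹)
    (hM : ∀ᵐ x ∂volume.restrict (openRing N R₀ R₁), u.toFun x ≤ M)
    (hMR : R₀ + √(M / c) ≤ Rε) :
    ∀ᵐ x ∂volume.restrict (openRing N R₀ R₁), u.toFun x ≤ quadraticBarrier N c R₀ x := by
  have hN' : (0 : ℝ) ≤ (N : ℝ) - 1 := by
    have : (1 : ℝ) ≤ N := by exact_mod_cast hN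
    linarith
  have ha : ∀ r : ℝ, HasDerivAt (fun r => 2 * c * (r - R₀)) ((fun _ => 2 * c : ℝ → ℝ) r) r :=
    fun r => by simpa using ((hasDerivAt_id r).sub_const R₀).const_mul (2 * c)
  have hnn : ∀ x, 0 ≤ quadraticBarrier N c R₀ x := fun x => by
    unfold quadraticBarrier; positivity
  have := hu.ae_mul_le hN hR₀ hR hf (s := 1) (Or.inl rfl)
    (contDiff_quadraticBarrier (c := c) hR₀) (fun x _ => hnn x) (fun x _ => hnn x) ha
    continuous_const (by simp) ?_ ?_
  · simpa using this
  · intro x hx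
    have hx1 := (mem_openRing.1 hx).1
    rw [(hasGradientAt_quadraticBarrier hR₀ x).gradient, max_eq_left hx1.le,
      max_eq_left (sub_nonneg.2 hx1.le), radialField]
    congr 2
    ring
  · filter_upwards [hfε, hM, ae_restrict_mem measurableSet_openRing] with x h1 h2 hx
    have hx1 := (mem_openRing.1 hx).1
    have hx0 : 0 < ‖x‖ := hR₀.trans hx1
    -- Inside `Rε` the bracket is `f + Δw` with `Δw = 2c (1 + (N - 1)(|x| - R₀)/|x|) ≤ ε`. Outside,
    -- `w ≥ M ≥ u` and the truncation is zero.
    rcases lt_or_ge ‖x‖ Rε with hxε | hxε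
    · refine mul_nonpos_of_nonpos_of_nonneg ?_ (ramp_nonneg _)
      have hf1 := h1 hxε
      have hpos : 0 < 1 + ((N : ℝ) - 1) / R₀ * (Rε - R₀) := by
        have : 0 ≤ ((N : ℝ) - 1) / R₀ * (Rε - R₀) :=
          mul_nonneg (div_nonneg hN' hR₀.le) (by linarith)
        linarith
      rw [← div_eq_mul_inv, le_div_iff₀ hpos] at hcε
      have h3 : ((N : ℝ) - 1) / ‖x‖ * (‖x‖ - R₀) ≤ ((N : ℝ) - 1) / R₀ * (Rε - R₀) := by
        have : 0 ≤ ‖x‖ - R₀ := by linarith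
        gcongr
      simp only [radialDiv]
      nlinarith
    · have h3 : √(M / c) ≤ ‖x‖ - R₀ := by linarith
      have h4 : M / c ≤ (‖x‖ - R₀) ^ 2 := (Real.sqrt_le_iff.1 h3).2
      rw [div_le_iff₀ hc] at h4
      have h5 : quadraticBarrier N c R₀ x = c * (‖x‖ - R₀) ^ 2 := by
        rw [quadraticBarrier, max_eq_left (by linarith)]
      rw [ramp_of_nonpos (by rw [h5]; linarith), mul_zero]

end Signorini

/-! ### The explicit constant and the size condition -/

theorem allowed_barrier_constant {N : ℕ} (hN : 1 ≤ N) {R₀ R₁ Rε ε : ℝ} (hR₀ : 0 < R₀)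
    (hε : 0 < ε) (hRε : R₀ < Rε) (hR : Rε ≤ R₁) :
    0 < ε * R₀ / (4 * N * R₁) ∧
      ε * R₀ / (4 * N * R₁) ≤ ε / 2 * (1 + ((N : ℝ) - 1) / R₀ * (Rε - R₀))⁻¹ := by
  have hN1 : (1 : ℝ) ≤ N := by exact_mod_cast hN
  have hR1 : 0 < R₁ := by linarith
  refine ⟨by positivity, ?_⟩
  have hnn : 0 ≤ ((N : ℝ) - 1) * (Rε - R₀) := mul_nonneg (by linarith) (by linarith)
  have e : 1 + ((N : ℝ) - 1) / R₀ * (Rε - R₀) = (R₀ + (N - 1) * (Rε - R₀)) / R₀ := by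
    field_simp
  rw [e, inv_div, div_mul_div_comm, div_le_div_iff₀ (by positivity) (by positivity)]
  -- Even `N * R₁` is an upper bound, so the constant has a factor `2` to spare.
  have : R₀ + ((N : ℝ) - 1) * (Rε - R₀) ≤ 2 * N * R₁ := by nlinarith
  have h2 : 0 < ε * R₀ := by positivity
  nlinarith

theorem eventually_exists_size_condition {N : ℕ} (hN : 1 ≤ N) {R₀ ε M : ℝ} (hR₀ : 0 < R₀)
    (hε : 0 < ε) (hM : 0 ≤ M) :
    ∀ᶠ R₁ : ℝ in atTop,
      ∃ Rε : ℝ, R₀ < Rε ∧ Rε ≤ R₁ ∧ R₀ + √(M / (ε * R₀ / (4 * N * R₁))) ≤ Rε := by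
  have hN1 : (0 : ℝ) < N := by exact_mod_cast hN
  set A := M * (4 * N) / (ε * R₀)
  have hA : 0 ≤ A := by positivity
  -- With this `c` the quotient `M / c = A R₁` is linear in `R₁`, so its root is only of order
  -- `√R₁`. The thresholds make `R₀` and `√(A R₁)` each at most `R₁ / 2`, and `Rε = R₁` works.
  filter_upwards [eventually_ge_atTop (2 * R₀), eventually_ge_atTop (4 * A),
    eventually_gt_atTop R₀] with R₁ h1 h2 h3
  refine ⟨R₁, h3, le_rfl, ?_⟩
  have hR1 : 0 < R₁ := by linarith
  have e : M / (ε * R₀ / (4 * N * R₁)) = A * R₁ := by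
    simp only [A]; field_simp
  have : √(A * R₁) ≤ R₁ / 2 := by
    rw [Real.sqrt_le_iff]
    exact ⟨by positivity, by nlinarith⟩
  rw [e]; linarith

theorem mainTheorem4 (N : ℕ) (hN : 1 ≤ N) (R₀ ε : ℝ) (hR₀ : 0 < R₀) (hε : 0 < ε) :
    -- the solution is bounded, and it vanishes on the inner sphere under the size condition
    (∀ R₁ : ℝ, R₀ < R₁ →
      ∀ f : EuclideanSpace ℝ (Fin N) → ℝ,
        MemLp f 2 (volume.restrict (openRing N R₀ R₁)) →
        MemLp f ∞ (volume.restrict (openRing N R₀ R₁)) →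
      ∀ u : SobolevH1 (openRing N R₀ R₁), IsSignoriniSolution f u →
        MemLp u.toFun ∞ (volume.restrict (openRing N R₀ R₁)) ∧
        ∀ Rε : ℝ, R₀ < Rε → Rε ≤ R₁ →
          (∀ᵐ x ∂(volume.restrict (ball (0 : EuclideanSpace ℝ (Fin N)) Rε \ ball 0 R₀)),
            f x ≤ -ε) →
          ∀ c : ℝ, 0 < c → c ≤ ε / 2 * (1 + ((N : ℝ) - 1) / R₀ * (Rε - R₀))⁻¹ →
            R₀ + √((eLpNorm u.toFun ∞ (volume.restrict (openRing N R₀ R₁))).toReal / c) ≤ Rε →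
            (∀ᵐ x ∂(volume.restrict (ball (0 : EuclideanSpace ℝ (Fin N)) Rε \ ball 0 R₀)),
              u.toFun x ≤ c * (‖x‖ - R₀) ^ 2) ∧
            ∀ τ : EuclideanSpace ℝ (Fin N) → ℝ, u.HasTraceOnSphere R₀ τ →
              (∀ᵐ x ∂(sphereMeasure N R₀), τ x = 0) ∧
              coincidenceSet R₀ τ = sphere 0 R₀) ∧
    -- the constant `ε R₀ / (4 N R₁)` is an allowed choice of `c`
    (∀ R₁ Rε : ℝ, R₀ < Rε → Rε ≤ R₁ →
      0 < ε * R₀ / (4 * N * R₁) ∧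
      ε * R₀ / (4 * N * R₁) ≤ ε / 2 * (1 + ((N : ℝ) - 1) / R₀ * (Rε - R₀))⁻¹) ∧
    -- for a given bound `M` the size condition with this `c` can be met for all large `R₁`
    (∀ M : ℝ, 0 ≤ M → ∀ᶠ R₁ : ℝ in atTop,
      ∃ Rε : ℝ, R₀ < Rε ∧ Rε ≤ R₁ ∧ R₀ + √(M / (ε * R₀ / (4 * N * R₁))) ≤ Rε) := by
  refine ⟨fun R₁ hR f hf hf' u hu => ?_, fun R₁ Rε h1 h2 =>
    allowed_barrier_constant hN hR₀ hε h1 h2, fun M hM =>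
    eventually_exists_size_condition hN hR₀ hε hM⟩
  have hu' := hu.memLp_top hN hR₀ hR hf hf'
  refine ⟨hu', fun Rε h1 h2 hfε c hc hcε hMR => ?_⟩
  have hmeas : MeasurableSet (ball (0 : EuclideanSpace ℝ (Fin N)) Rε \ ball 0 R₀) :=
    measurableSet_ball.diff measurableSet_ball
  have hfε' : ∀ᵐ x ∂volume.restrict (openRing N R₀ R₁), ‖x‖ < Rε → f x ≤ -ε := by
    rw [ae_restrict_iff' hmeas] at hfε
    refine (ae_restrict_iff' measurableSet_openRing).2 ?_
    filter_upwards [hfε] with x hx hxr hxε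
    refine hx ⟨by simpa using hxε, ?_⟩
    simpa using (mem_openRing.1 hxr).1.le
  have hM := hu'.ae_norm_le_toReal_eLpNorm.mono fun x hx => (le_abs_self _).trans hx
  have hle := hu.ae_le_quadraticBarrier hN hR₀ hR hf hfε' hc hcε hM hMR
  refine ⟨?_, fun τ hτ => ?_⟩
  · rw [ae_restrict_iff' measurableSet_openRing] at hle
    -- The region `ball 0 Rε \ ball 0 R₀` contains the inner sphere, which the open ring does not;
    -- it is a null set.
    have hsph : ∀ᵐ x : EuclideanSpace ℝ (Fin N), x ∉ sphere (0 : EuclideanSpace ℝ (Fin N)) R₀ :=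
      measure_eq_zero_iff_ae_notMem.1 (Measure.addHaar_sphere_of_ne_zero _ _ hR₀.ne')
    refine (ae_restrict_iff' hmeas).2 ?_
    filter_upwards [hle, hsph] with x hx hxs hxm
    have h3 : ‖x‖ < Rε := by simpa using hxm.1
    have h4 : R₀ ≤ ‖x‖ := by simpa using hxm.2
    have h5 : R₀ < ‖x‖ := lt_of_le_of_ne h4 fun h => hxs (by simp [h])
    have := hx (mem_openRing.2 ⟨h5, h3.trans_le h2⟩)
    rwa [quadraticBarrier, max_eq_left (by linarith)] at this
  · have hτ0 := ae_trace_eq_zero_of_le hN hR₀ hR hu.1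
      (contDiff_quadraticBarrier (c := c) hR₀) (fun x hx => by simp [quadraticBarrier, hx]) hle hτ
    exact ⟨hτ0, coincidenceSet_eq_sphere hR₀ hτ0⟩
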